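/- For a point $P=(a_1/b_1,\ldots,a_n/b_n)\in\mathbb{Q}^n$ with $a_j,b_j\in\mathbb{Z}$, $b_j\ge 1$ and $\gcd(a_j,b_j)=1$ for all $j$, put $H(P)=\max_{1\le j\le n}\max\{|a_j|,b_j\}$, and for $X\subset\mathbb{R}^n$ and real $H$ let $$N(X,H)=\#\{P\in X\cap\mathbb{Q}^n : H(P)\le H\}.$$ **Theorem 1.4.** Let $b,c\ge 2$ be integers and let $H\ge 3$ be a real number. Let $F(x,y)\in\mathbb{R}[x,y]$ be irreducible in $\mathbb{R}[x,y]$ and of bidegree $(b,c)$, that is, of degree $b$ in $x$ and degree $c$ in $y$. Let $d=\max(b,c)$ and $X=\{(x,y)\in\mathbb{R}^2 : F(x,y)=0\}$. Then $$N(X,H)\le (6d)^{10}\,4^d\,H^{2/d}\,(\log H)^5 .$$ -/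

import Mathlib

/-- The (non-projective) height of `P = (a₁/b₁, …, aₙ/bₙ) ∈ ℚⁿ`, each coordinate in lowest terms
with positive denominator: the maximum over `j` of `|a_j|` and `b_j`. -/
def ratHeight {n : ℕ} (P : Fin n → ℚ) : ℕ :=
  Finset.univ.sup fun j => max (P j).num.natAbs (P j).den

/-- `X(ℚ, H)`: the rational points of height at most `H` on `X ⊆ ℝⁿ`. -/
def ratPoints {n : ℕ} (X : Set (Fin n → ℝ)) (H : ℝ) : Set (Fin n → ℚ) :=
  {P | (fun j => (P j : ℝ)) ∈ X ∧ (ratHeight P : ℝ) ≤ H}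

/-- The set `X(ℚ, H)` is finite, so that its `Set.ncard` is its number of elements. -/
theorem ratPoints_finite {n : ℕ} (X : Set (Fin n → ℝ)) (H : ℝ) : (ratPoints X H).Finite := by
  have hfin : {q : ℚ | max q.num.natAbs q.den ≤ ⌊H⌋₊}.Finite := by
    refine Set.Finite.of_finite_image (f := fun q : ℚ => (q.num, q.den)) ?_ ?_
    · refine ((Set.finite_Icc (-(⌊H⌋₊ : ℤ)) ⌊H⌋₊).prod (Set.finite_Iic ⌊H⌋₊)).subset ?_
      rintro _ ⟨q, hq, rfl⟩
      simp only [Set.mem_ofPred_eq, max_le_iff] at hq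
      simp only [Set.mem_prod, Set.mem_Icc, Set.mem_Iic]
      omega
    · intro p _ q _ h
      simp only [Prod.mk.injEq] at h
      exact Rat.ext h.1 h.2
  refine (Set.Finite.pi' (fun _ : Fin n => hfin)).subset ?_
  rintro P ⟨-, hP⟩ j
  exact (Finset.le_sup (f := fun j => max (P j).num.natAbs (P j).den)
    (Finset.mem_univ j)).trans (Nat.le_floor hP)

/-- `N(X, H) = #X(ℚ, H)`. -/
noncomputable def countRatPoints {n : ℕ} (X : Set (Fin n → ℝ)) (H : ℝ) : ℕ :=
  (ratPoints X H).ncard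

/-- The real zero set of `F ∈ ℝ[x, y]`, where `x` and `y` are the variables `0` and `1`. -/
def realZeroSet (F : MvPolynomial (Fin 2) ℝ) : Set (Fin 2 → ℝ) :=
  {p | MvPolynomial.eval p F = 0}

/-- `F ∈ ℝ[x, y]` has bidegree `(b, c)`: degree exactly `b` in `x` and exactly `c` in `y`. -/
def HasBidegree (F : MvPolynomial (Fin 2) ℝ) (b c : ℕ) : Prop :=
  F.degreeOf 0 = b ∧ F.degreeOf 1 = c

/-!
This is the determinant method of Bombieri–Pila and Heath-Brown. Exchanging the variables, let `F`
have bidegree `(b, d)` with `b ≤ d`. Unless the points of height at most `H` lie on a second curve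
of that bidegree and are few by Bézout's theorem, Siegel's lemma shows that a multiple of `F` has
integer coefficients of size `H ^ O(d ^ 3)`.

At a point `P` of the curve with `∂F/∂Y ≠ 0`, some prime `p ≪ d ^ 3 log H` divides neither the
denominators of `P` nor the numerator of `∂F/∂Y`. By Hensel's lemma the points with this `p` in a
fixed residue class modulo `p ^ k` lie on the graph of a function over `ℤ_p`, so that a determinant
of `D` monomials at `D` of them is divisible by `p ^ (k D (D - 1) / 2)`. With monomials of bidegree
at most `(m, d - 1)`, `m ≈ log H`, the determinant is smaller than this as soon as
`p ^ k ≫ H ^ (2 / d)`, and hence vanishes: the points lie on a curve that does not contain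
`F = 0`, and Bézout's theorem bounds their number. There are at most `d p ^ k` residue classes
on the curve, and the points with `∂F/∂Y = 0` are again counted by Bézout's theorem.
-/

open Polynomial
open scoped Polynomial.Bivariate

section BidegreeLE

variable {R : Type*} [CommRing R] {f g : R[X][Y]} {b c m e : ℕ}

/-- `f ∈ R[X][Y]` has degree at most `b` in `X` and at most `c` in `Y`. -/
structure BidegreeLE (f : R[X][Y]) (b c : ℕ) : Prop where
  natDegree_le : f.natDegree ≤ c
  natDegree_coeff_le : ∀ j, (f.coeff j).natDegree ≤ b

namespace BidegreeLE

theorem map {S : Type*} [CommRing S] (hf : BidegreeLE f b c) (φ : R →+* S) :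
    BidegreeLE (f.map (mapRingHom φ)) b c where
  natDegree_le := natDegree_map_le.trans hf.natDegree_le
  natDegree_coeff_le j := by
    rw [coeff_map, coe_mapRingHom]
    exact natDegree_map_le.trans (hf.natDegree_coeff_le j)

theorem derivative (hf : BidegreeLE f b c) : BidegreeLE (derivative f) b (c - 1) where
  natDegree_le := (natDegree_derivative_le f).trans (Nat.sub_le_sub_right hf.natDegree_le 1)
  natDegree_coeff_le j := by
    rw [coeff_derivative, show ((j : R[X]) + 1) = C ((j : R) + 1) by simp]
    exact (natDegree_mul_C_le _ _).trans (hf.natDegree_coeff_le _)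

theorem mono {b' c' : ℕ} (hf : BidegreeLE f b c) (hb : b ≤ b') (hc : c ≤ c') :
    BidegreeLE f b' c' :=
  ⟨hf.natDegree_le.trans hc, fun j => (hf.natDegree_coeff_le j).trans hb⟩

theorem evalEval_eq_sum (hf : BidegreeLE f b c) (x y : R) :
    f.evalEval x y = ∑ a : Fin (b + 1) × Fin (c + 1),
      (f.coeff a.2).coeff a.1 * (x ^ (a.1 : ℕ) * y ^ (a.2 : ℕ)) := by
  rw [evalEval, eval_eq_sum_range' (Nat.lt_succ_of_le hf.natDegree_le), eval_finsetSum,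
    Fintype.sum_prod_type_right, Finset.sum_range]
  refine Finset.sum_congr rfl fun j _ => ?_
  rw [eval_mul, eval_pow, eval_C,
    eval_eq_sum_range' (Nat.lt_succ_of_le (hf.natDegree_coeff_le j)), Finset.sum_mul,
    Finset.sum_range]
  exact Finset.sum_congr rfl fun i _ => mul_assoc _ _ _

end BidegreeLE

theorem natDegree_resultant_le (hf : BidegreeLE f b c) (hg : BidegreeLE g m e) :
    (resultant f g).natDegree ≤ b * e + m * c := by
  have hentry_g (i : Fin (f.natDegree + g.natDegree)) (j : Fin f.natDegree) :
      (sylvester f g _ _ i (Fin.castAdd _ j)).natDegree ≤ m := by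
    simp only [sylvester, Matrix.of_apply, Fin.addCases_left]
    split_ifs
    exacts [hg.natDegree_coeff_le _, by simp]
  have hentry_f (i : Fin (f.natDegree + g.natDegree)) (j : Fin g.natDegree) :
      (sylvester f g _ _ i (Fin.natAdd _ j)).natDegree ≤ b := by
    simp only [sylvester, Matrix.of_apply, Fin.addCases_right]
    split_ifs
    exacts [hf.natDegree_coeff_le _, by simp]
  rw [resultant, Matrix.det_apply]
  refine natDegree_sum_le_of_forall_le _ _ fun σ _ => (natDegree_smul_le _ _).trans ?_
  rw [Fin.prod_univ_add]
  calc _ ≤ _ := natDegree_mul_le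
    _ ≤ ∑ _j : Fin f.natDegree, m + ∑ _j : Fin g.natDegree, b :=
      add_le_add
        ((natDegree_prod_le _ _).trans (Finset.sum_le_sum fun j _ => hentry_g _ j))
        ((natDegree_prod_le _ _).trans (Finset.sum_le_sum fun j _ => hentry_f _ j))
    _ = b * g.natDegree + m * f.natDegree := by simp; ring
    _ ≤ b * e + m * c := by gcongr; exacts [hg.natDegree_le, hf.natDegree_le]

end BidegreeLE

/-! ### Bézout's theorem -/

theorem card_le_mul_card_image_fst {α β : Type*} [DecidableEq α] {S : Finset (α × β)} {n : ℕ}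
    (h : ∀ (x : α) (T : Finset β), (∀ y ∈ T, (x, y) ∈ S) → T.card ≤ n) :
    S.card ≤ n * (S.image Prod.fst).card := by
  classical
  refine Finset.card_le_mul_card_image S n fun x _ => ?_
  have hinj : Set.InjOn Prod.snd (S.filter fun P => P.1 = x : Set (α × β)) := fun P hP Q hQ heq =>
    Prod.ext ((Finset.mem_filter.1 hP).2.trans (Finset.mem_filter.1 hQ).2.symm) heq
  rw [← Finset.card_image_of_injOn hinj]
  refine h x _ fun y hy => ?_
  obtain ⟨P, hP, rfl⟩ := Finset.mem_image.1 hy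
  obtain ⟨hPS, rfl⟩ := Finset.mem_filter.1 hP
  exact hPS

section Bezout

variable {K : Type*} [Field K] {f g : K[X][Y]}

theorem resultant_ne_zero_of_irreducible (hf : Irreducible f) (hdeg : f.natDegree ≠ 0)
    (hg : ¬ f ∣ g) : resultant f g ≠ 0 := by
  have hprim : f.IsPrimitive := hf.isPrimitive hdeg
  let ψ := algebraMap K[X] (FractionRing K[X])
  have hψ : Function.Injective ψ := IsFractionRing.injective K[X] (FractionRing K[X])
  have hirr : Irreducible (f.map ψ) := (hprim.irreducible_iff_irreducible_map_fraction_map).1 hf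
  have hcop : IsCoprime (f.map ψ) (g.map ψ) := hirr.coprime_iff_not_dvd.2 fun hdvd =>
    hg ((IsPrimitive.dvd_iff_fraction_map_dvd_fraction_map (FractionRing K[X]) hprim).2 hdvd)
  intro h0
  have hmap : resultant (f.map ψ) (g.map ψ) = 0 := by
    rw [natDegree_map_eq_of_injective hψ, natDegree_map_eq_of_injective hψ, resultant_map_map, h0,
      map_zero]
  exact (resultant_eq_zero_iff.1 hmap).2 hcop

theorem map_evalRingHom_ne_zero (hf : Irreducible f) (hdeg : f.natDegree ≠ 0) (x : K) :
    f.map (evalRingHom x) ≠ 0 := by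
  intro h0
  have hdvd : C (X - C x) ∣ f := by
    rw [C_dvd_iff_dvd_coeff]
    intro i
    rw [dvd_iff_isRoot, IsRoot]
    simpa using congrArg (fun r => coeff r i) h0
  exact not_isUnit_X_sub_C x (hf.isPrimitive hdeg _ hdvd)

theorem card_common_zeros_le {b c m e : ℕ} (hf : Irreducible f) (hdeg : f.natDegree ≠ 0)
    (hfb : BidegreeLE f b c) (hgb : BidegreeLE g m e) (hg : ¬ f ∣ g) (S : Finset (K × K))
    (hfS : ∀ P ∈ S, f.evalEval P.1 P.2 = 0) (hgS : ∀ P ∈ S, g.evalEval P.1 P.2 = 0) :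
    S.card ≤ c * (b * e + m * c) := by
  classical
  have hfst : (S.image Prod.fst).card ≤ b * e + m * c := by
    have hres := resultant_ne_zero_of_irreducible hf hdeg hg
    obtain ⟨p, q, -, -, hpq⟩ :=
      exists_mul_add_mul_eq_C_resultant f g le_rfl le_rfl (Or.inl hdeg)
    refine (card_le_degree_of_subset_roots fun x hx => ?_).trans (natDegree_resultant_le hfb hgb)
    obtain ⟨P, hP, rfl⟩ := Finset.mem_image.1 hx
    have hP0 := congrArg (evalEval P.1 P.2) hpq
    rw [evalEval_add, evalEval_mul, evalEval_mul, hfS P hP, hgS P hP, evalEval_C] at hP0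
    exact (mem_roots hres).2 (by simpa using hP0.symm)
  have hfibre (x : K) (T : Finset K) (hT : ∀ y ∈ T, (x, y) ∈ S) : T.card ≤ c := by
    refine (card_le_degree_of_subset_roots (p := f.map (evalRingHom x)) fun y hy => ?_).trans
      (natDegree_map_le.trans hfb.natDegree_le)
    rw [mem_roots (map_evalRingHom_ne_zero hf hdeg _), IsRoot, map_evalRingHom_eval]
    exact hfS _ (hT y hy)
  calc S.card ≤ c * (S.image Prod.fst).card :=
        card_le_mul_card_image_fst hfibre
    _ ≤ c * (b * e + m * c) := by gcongr

end Bezout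

/-! ### Determinants at the points near a smooth point -/

theorem sum_range_card_le_sum_of_injective {ι : Type*} [Fintype ι] {l : ι → ℕ}
    (hl : Function.Injective l) : ∑ i ∈ Finset.range (Fintype.card ι), i ≤ ∑ i, l i := by
  classical
  have hl' : Function.Injective fun i => (l i : ℤ) := Nat.cast_injective.comp hl
  have h := Finset.sum_range_le_sum (s := Finset.univ.image fun i => (l i : ℤ)) (c := 0) (by simp)
  rw [Finset.card_image_of_injective _ hl', Finset.sum_image hl'.injOn, Finset.card_univ] at h
  zify
  simpa using h

section Determinants

variable {A : Type*} [CommRing A] {ι : Type*} [Fintype ι] [DecidableEq ι]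

theorem pow_dvd_det_eval (q : A) (z : ι → A) (g : ι → A[X]) :
    q ^ (Fintype.card ι).choose 2 ∣ (Matrix.of fun i j => (g j).eval (q * z i)).det := by
  have hrow (j : ι) : (fun i => (g j).eval (q * z i)) =
      ∑ l ∈ Finset.range ((g j).natDegree + 1), ((g j).coeff l * q ^ l) • fun i => z i ^ l := by
    ext i
    simp only [Finset.sum_apply, Pi.smul_apply, smul_eq_mul, eval_eq_sum_range]
    exact Finset.sum_congr rfl fun l _ => by ring
  have hexpand : (Matrix.of fun i j => (g j).eval (q * z i)).det =
      ∑ l ∈ Fintype.piFinset fun j => Finset.range ((g j).natDegree + 1),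
        (∏ j, (g j).coeff (l j) * q ^ l j) * (Matrix.of fun j i => z i ^ l j).det := by
    rw [← Matrix.det_transpose]
    refine (congrArg Matrix.detRowAlternating (funext hrow)).trans ?_
    exact (MultilinearMap.map_sum_finset _ _ _).trans
      (Finset.sum_congr rfl fun l _ => MultilinearMap.map_smul_univ _ _ _)
  rw [hexpand]
  refine Finset.dvd_sum fun l _ => ?_
  by_cases hl : Function.Injective l
  · rw [Finset.prod_mul_distrib, Finset.prod_pow_eq_pow_sum, Nat.choose_two_right,
      ← Finset.sum_range_id]
    exact ((pow_dvd_pow q (sum_range_card_le_sum_of_injective hl)).mul_left _).mul_right _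
  · obtain ⟨i, j, hij, hne⟩ := Function.not_injective_iff.1 hl
    rw [Matrix.det_zero_of_row_eq hne (by ext; simp [hij]), mul_zero]
    exact dvd_zero _

theorem dvd_det_sub_det {q : A} {M N : Matrix ι ι A} (h : ∀ i j, q ∣ M i j - N i j) :
    q ∣ M.det - N.det := by
  have hmap : (Ideal.Quotient.mk (Ideal.span {q})).mapMatrix M =
      (Ideal.Quotient.mk (Ideal.span {q})).mapMatrix N := by
    ext i j
    exact (Ideal.Quotient.mk_eq_mk_iff_sub_mem _ _).2 (Ideal.mem_span_singleton.2 (h i j))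
  rw [← Ideal.mem_span_singleton, ← Ideal.Quotient.mk_eq_mk_iff_sub_mem, RingHom.map_det,
    RingHom.map_det, hmap]

end Determinants

section SmoothPoints

variable {A : Type*} [CommRing A]

theorem eval_eval_eq_evalEval (G : A[X][Y]) (φ : A[X]) (s : A) :
    (G.eval φ).eval s = G.evalEval s (φ.eval s) := by
  rw [← map_evalRingHom_eval, eval_map]
  exact (eval₂_hom (evalRingHom s) φ).symm

theorem evalEval_map_compRingHom (G : A[X][Y]) (r : A[X]) (x y : A) :
    (G.map (compRingHom r)).evalEval x y = G.evalEval (r.eval x) y := by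
  rw [← map_evalRingHom_eval, ← map_evalRingHom_eval, Polynomial.map_map]
  congr 2
  ext <;> simp

theorem dvd_evalEval_sub (g : A[X][Y]) {q x y x₀ y₀ : A} (hx : q ∣ x - x₀) (hy : q ∣ y - y₀) :
    q ∣ g.evalEval x y - g.evalEval x₀ y₀ := by
  have h1 : q ∣ g.evalEval x y - g.evalEval x y₀ := by
    rw [← map_evalRingHom_eval, ← map_evalRingHom_eval]
    exact hy.trans (sub_dvd_eval_sub _ _ _)
  have h2 : q ∣ g.evalEval x y₀ - g.evalEval x₀ y₀ := hx.trans (sub_dvd_eval_sub _ _ _)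
  simpa using dvd_add h1 h2

theorem isCoprime_of_isUnit_of_dvd_sub {q u v : A} (hu : IsUnit u) (h : q ∣ v - u) :
    IsCoprime q v := by
  obtain ⟨r, hr⟩ := h
  rw [eq_add_of_sub_eq hr, IsCoprime.mul_add_left_right_iff]
  exact isCoprime_one_right.of_isCoprime_of_dvd_right hu.dvd

/-- Newton iteration. -/
theorem exists_X_pow_dvd_eval (G : A[X][Y]) (y : A) (h0 : G.evalEval 0 y = 0)
    (hu : IsUnit (G.derivative.evalEval 0 y)) (n : ℕ) :
    ∃ φ : A[X], φ.eval 0 = y ∧ X ^ (n + 1) ∣ G.eval φ := by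
  induction n with
  | zero =>
    refine ⟨C y, eval_C, ?_⟩
    rw [zero_add, pow_one, X_dvd_iff, coeff_zero_eq_eval_zero]
    exact h0
  | succ n ih =>
    obtain ⟨φ, hφ, r, hr⟩ := ih
    obtain ⟨u, hu⟩ := hu
    set a : A := -(r.eval 0 * ↑u⁻¹) with ha
    obtain ⟨k, hk⟩ := G.binomExpansion φ (C a * X ^ (n + 1))
    have hlin : X ∣ r + G.derivative.eval φ * C a := by
      rw [X_dvd_iff, coeff_zero_eq_eval_zero]
      simp [eval_eval_eq_evalEval, hφ, ← hu, ha, mul_comm]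
    obtain ⟨t, ht⟩ := hlin
    refine ⟨φ + C a * X ^ (n + 1), by simp [hφ], t + k * C a ^ 2 * X ^ n, ?_⟩
    rw [hk, hr]
    linear_combination X ^ (n + 1) * ht

theorem pow_dvd_sub_of_pow_dvd_eval_sub {f : A[X]} {q y y' : A} {N : ℕ}
    (hcop : IsCoprime q (f.derivative.eval y)) (hy : q ∣ y' - y)
    (hf : q ^ N ∣ f.eval y' - f.eval y) : q ^ N ∣ y' - y := by
  obtain ⟨k, hk⟩ := f.binomExpansion y (y' - y)
  obtain ⟨r, hr⟩ := hy
  have hcop' : IsCoprime q (f.derivative.eval y + q * (k * r)) :=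
    IsCoprime.add_mul_left_right_iff.2 hcop
  refine hcop'.pow_left.dvd_of_dvd_mul_left ?_
  convert hf using 1
  rw [add_sub_cancel] at hk
  linear_combination - hk - k * (y' - y) * hr

theorem exists_polynomial_pow_dvd_sub {f : A[X][Y]} {x₀ y₀ : A} (h0 : f.evalEval x₀ y₀ = 0)
    (hu : IsUnit (f.derivative.evalEval x₀ y₀)) (q : A) (N : ℕ) :
    ∃ φ : A[X], ∀ z y, q ∣ y - y₀ → f.evalEval (q * z + x₀) y = 0 →
      q ^ N ∣ y - φ.eval (q * z) := by
  obtain ⟨φ, hφ0, hφ⟩ := exists_X_pow_dvd_eval (f.map (compRingHom (X + C x₀))) y₀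
    (by simpa [evalEval_map_compRingHom] using h0)
    (by simpa [derivative_map, evalEval_map_compRingHom] using hu) N
  refine ⟨φ, fun z y hy hf => ?_⟩
  have hφz : q ∣ φ.eval (q * z) - y₀ := by
    rw [← hφ0]
    exact (Dvd.intro z (by ring)).trans (sub_dvd_eval_sub (q * z) 0 φ)
  have hgraph : q ^ N ∣ f.evalEval (q * z + x₀) (φ.eval (q * z)) := by
    obtain ⟨r, hr⟩ := hφ
    have h := congrArg (eval (q * z)) hr
    rw [eval_eval_eq_evalEval, evalEval_map_compRingHom] at h
    simp only [eval_add, eval_mul, eval_pow, eval_X, eval_C] at h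
    rw [h, mul_pow, pow_succ]
    exact ((dvd_mul_right _ _).mul_right _).mul_right _
  have hcop : IsCoprime q (f.derivative.evalEval (q * z + x₀) (φ.eval (q * z))) :=
    isCoprime_of_isUnit_of_dvd_sub hu (dvd_evalEval_sub _ (by simp) hφz)
  refine pow_dvd_sub_of_pow_dvd_eval_sub (f := f.map (evalRingHom (q * z + x₀))) ?_ ?_ ?_
  · rwa [derivative_map, map_evalRingHom_eval]
  · simpa using dvd_sub hy hφz
  · rwa [map_evalRingHom_eval, map_evalRingHom_eval, hf, zero_sub, dvd_neg]

/-- Modulo powers of `q`, the points of a curve that are congruent to one smooth point lie on the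
graph of a polynomial. -/
theorem pow_dvd_det_monomials {ι : Type*} [Fintype ι] [DecidableEq ι] {f : A[X][Y]} {q x₀ y₀ : A}
    (h0 : f.evalEval x₀ y₀ = 0) (hu : IsUnit (f.derivative.evalEval x₀ y₀)) {x y : ι → A}
    (hx : ∀ i, q ∣ x i - x₀) (hy : ∀ i, q ∣ y i - y₀) (hf : ∀ i, f.evalEval (x i) (y i) = 0)
    (e : ι → ℕ × ℕ) :
    q ^ (Fintype.card ι).choose 2 ∣ (Matrix.of fun i j => x i ^ (e j).1 * y i ^ (e j).2).det := by
  choose z hz using hx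
  have hxz (i : ι) : x i = q * z i + x₀ := by rw [← hz i, sub_add_cancel]
  obtain ⟨φ, hφ⟩ := exists_polynomial_pow_dvd_sub h0 hu q ((Fintype.card ι).choose 2)
  have hmonomials : q ^ (Fintype.card ι).choose 2 ∣
      (Matrix.of fun i j => x i ^ (e j).1 * y i ^ (e j).2).det -
        (Matrix.of fun i j => ((X + C x₀) ^ (e j).1 * φ ^ (e j).2).eval (q * z i)).det := by
    refine dvd_det_sub_det fun i j => ?_
    have hyφ := hφ (z i) (y i) (hy i) (hxz i ▸ hf i)
    simp only [Matrix.of_apply, eval_mul, eval_pow, eval_add, eval_X, eval_C, ← hxz, ← mul_sub]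
    exact (hyφ.trans (sub_dvd_pow_sub_pow _ _ _)).mul_left _
  exact (dvd_sub_left (pow_dvd_det_eval q z _)).1 hmonomials

end SmoothPoints

/-! ### Integral equations with small coefficients -/

section LinearRelations

variable {ι K : Type*} [Fintype ι] [Field K]

theorem dotProduct_eq_zero_of_mem_span {s : Set (ι → K)} {γ v : ι → K}
    (hs : ∀ u ∈ s, γ ⬝ᵥ u = 0) (hv : v ∈ Submodule.span K s) : γ ⬝ᵥ v = 0 :=
  have h : Submodule.span K s ≤ LinearMap.ker (dotProductBilin K K γ) :=
    Submodule.span_le.2 hs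
  h hv

theorem span_ne_top_of_dotProduct_eq_zero {s : Set (ι → K)} {γ : ι → K} (hγ : γ ≠ 0)
    (hs : ∀ u ∈ s, γ ⬝ᵥ u = 0) : Submodule.span K s ≠ ⊤ := fun htop =>
  hγ (dotProduct_eq_zero γ fun _ => dotProduct_eq_zero_of_mem_span hs (htop ▸ Submodule.mem_top))

theorem exists_dotProduct_eq_zero_of_det_eq_zero [DecidableEq ι] {s : Set (ι → K)}
    (hs : ∀ r : ι → ι → K, (∀ i, r i ∈ s) → (Matrix.of r).det = 0) :
    ∃ γ : ι → K, γ ≠ 0 ∧ ∀ v ∈ s, γ ⬝ᵥ v = 0 := by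
  have htop : Submodule.span K s ≠ ⊤ := by
    intro htop
    obtain ⟨r, hrs, -, hr⟩ := Submodule.exists_fun_fin_finrank_span_eq K s
    have hcard : Fintype.card ι = Module.finrank K (Submodule.span K s) := by
      rw [htop, finrank_top, Module.finrank_fintype_fun_eq_card]
    have hunit : LinearIndependent K (Matrix.of (r ∘ Fintype.equivFinOfCardEq hcard)).row :=
      hr.comp _ (Equiv.injective _)
    rw [Matrix.linearIndependent_rows_iff_isUnit, Matrix.isUnit_iff_isUnit_det,
      hs (r ∘ _) fun i => hrs _] at hunit
    exact not_isUnit_zero hunit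
  obtain ⟨φ, hφ, hker⟩ := Submodule.exists_le_ker_of_lt_top _ (lt_top_iff_ne_top.2 htop)
  refine ⟨(dotProductEquiv K ι).symm φ, by simpa using hφ, fun v hv => ?_⟩
  rw [← dotProductEquiv_apply_apply, LinearEquiv.apply_symm_apply]
  exact hker (Submodule.subset_span hv)

open scoped Matrix.Norms.Elementwise in
theorem exists_small_int_mulVec_eq_zero {r : ℕ} (hr : r < Fintype.card ι)
    {M : Matrix (Fin r) ι ℤ} {B : ℝ} (hB : 1 ≤ B) (hM : ∀ i a, |(M i a : ℝ)| ≤ B) :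
    ∃ w : ι → ℤ, w ≠ 0 ∧
      (∀ a, |(w a : ℝ)| ≤ (Fintype.card ι * B) ^ (Fintype.card ι - 1)) ∧ M.mulVec w = 0 := by
  set N := Fintype.card ι
  have hrN : (r : ℝ) + 1 ≤ N := by exact_mod_cast hr
  have hN1 : (1 : ℝ) ≤ N := le_trans (by simp) hrN
  have hNB : 1 ≤ N * B := one_le_mul_of_one_le_of_one_le hN1 hB
  rcases r.eq_zero_or_pos with rfl | hr0
  · have : Nonempty ι := Fintype.card_pos_iff.1 hr
    refine ⟨1, one_ne_zero, fun a => ?_, Subsingleton.elim _ _⟩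
    simpa using one_le_pow₀ hNB
  · obtain ⟨w, hw0, hMw, hw⟩ :=
      Int.Matrix.exists_ne_zero_int_vec_norm_le M (by simpa using hr) (by simpa using hr0)
    refine ⟨w, hw0, fun a => ?_, hMw⟩
    have hM1 : max 1 ‖M‖ ≤ B :=
      max_le hB ((Matrix.norm_le_iff (by positivity)).2 fun i a => by
        rw [Int.norm_eq_abs]; exact hM i a)
    calc |(w a : ℝ)| = ‖w a‖ := (Int.norm_eq_abs _).symm
      _ ≤ ‖w‖ := norm_le_pi_norm w a
      _ ≤ (N * max 1 ‖M‖) ^ ((r : ℝ) / (N - r)) := by simpa using hw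
      _ ≤ (N * B) ^ ((r : ℝ) / (N - r)) :=
          Real.rpow_le_rpow (by positivity) (by gcongr) (div_nonneg (by positivity) (by linarith))
      _ ≤ (N * B) ^ ((N - 1 : ℕ) : ℝ) := by
          refine Real.rpow_le_rpow_of_exponent_le hNB ?_
          rw [Nat.cast_pred (by omega), div_le_iff₀ (by linarith)]
          nlinarith [r.cast_nonneg (α := ℝ)]
      _ = (N * B) ^ (N - 1) := Real.rpow_natCast _ _

theorem exists_small_int_dotProduct_eq_zero [CharZero K] {s : Set (ι → ℤ)} {B : ℝ} (hB : 1 ≤ B)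
    (hs : ∀ v ∈ s, ∀ a, |(v a : ℝ)| ≤ B) {γ : ι → K} (hγ : γ ≠ 0)
    (hγs : ∀ v ∈ s, γ ⬝ᵥ (fun a => (v a : K)) = 0) :
    ∃ w : ι → ℤ, w ≠ 0 ∧
      (∀ a, |(w a : ℝ)| ≤ (Fintype.card ι * B) ^ (Fintype.card ι - 1)) ∧ ∀ v ∈ s, w ⬝ᵥ v = 0 := by
  let cast : (ι → ℤ) → ι → K := fun v a => v a
  have hspan : Submodule.span K (cast '' s) ≠ ⊤ :=
    span_ne_top_of_dotProduct_eq_zero hγ (by rintro _ ⟨v, hv, rfl⟩; exact hγs v hv)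
  obtain ⟨u, hus, hu, -⟩ := Submodule.exists_fun_fin_finrank_span_eq K (cast '' s)
  choose M hMs hMu using hus
  obtain ⟨w, hw0, hwb, hMw⟩ := exists_small_int_mulVec_eq_zero
    (by simpa using Submodule.finrank_lt hspan) (M := Matrix.of M) hB fun i => hs _ (hMs i)
  refine ⟨w, hw0, hwb, fun v hv => ?_⟩
  have hcast (v : ι → ℤ) : cast w ⬝ᵥ cast v = ((w ⬝ᵥ v : ℤ) : K) := by
    simp [cast, dotProduct]
  rw [← Int.cast_eq_zero (α := K), ← hcast]
  have hmem : cast v ∈ Submodule.span K (Set.range u) :=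
    hu.ge (Submodule.subset_span (Set.mem_image_of_mem cast hv))
  refine dotProduct_eq_zero_of_mem_span ?_ hmem
  rintro _ ⟨i, rfl⟩
  rw [← hMu, hcast, dotProduct_comm, Int.cast_eq_zero]
  exact congrFun hMw i

end LinearRelations

section Box

/-- The exponents `(i, j)` of the monomials `X ^ i * Y ^ j` of bidegree at most `(b, c)`. -/
abbrev Box (b c : ℕ) : Type := Fin (b + 1) × Fin (c + 1)

variable {R : Type*} [CommRing R] {b c : ℕ}

/-- The polynomial with the prescribed coefficients in the box of bidegree `(b, c)`. -/
noncomputable def polyOfCoeffs (γ : Box b c → R) : R[X][Y] :=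
  ∑ a, monomial (a.2 : ℕ) (monomial (a.1 : ℕ) (γ a))

theorem coeff_coeff_polyOfCoeffs (γ : Box b c → R) (a : Box b c) :
    ((polyOfCoeffs γ).coeff a.2).coeff a.1 = γ a := by
  rw [polyOfCoeffs, finsetSum_coeff, finsetSum_coeff, Finset.sum_eq_single a]
  · simp
  · intro a' _ hne
    rw [coeff_monomial]
    split_ifs with h₂
    · rw [coeff_monomial, if_neg fun h₁ => hne (Prod.ext (Fin.ext h₁) (Fin.ext h₂))]
    · exact coeff_zero _
  · simp

theorem bidegreeLE_polyOfCoeffs (γ : Box b c → R) : BidegreeLE (polyOfCoeffs γ) b c where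
  natDegree_le := natDegree_sum_le_of_forall_le _ _ fun a _ =>
    (natDegree_monomial_le _).trans (Nat.lt_succ_iff.1 a.2.2)
  natDegree_coeff_le j := by
    rw [polyOfCoeffs, finsetSum_coeff]
    refine natDegree_sum_le_of_forall_le _ _ fun a _ => ?_
    rw [coeff_monomial]
    split_ifs
    · exact (natDegree_monomial_le _).trans (Nat.lt_succ_iff.1 a.1.2)
    · simp

theorem polyOfCoeffs_ne_zero {γ : Box b c → R} (hγ : γ ≠ 0) : polyOfCoeffs γ ≠ 0 := by
  rintro h
  refine hγ (funext fun a => ?_)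
  rw [← coeff_coeff_polyOfCoeffs γ a, h]
  simp

theorem abs_coeff_polyOfCoeffs_le {γ : Box b c → ℤ} {W : ℝ} (hW : ∀ a, |(γ a : ℝ)| ≤ W)
    (i j : ℕ) : |(((polyOfCoeffs γ).coeff j).coeff i : ℝ)| ≤ W := by
  have hW0 : 0 ≤ W := (abs_nonneg _).trans (hW 0)
  by_cases hj : j < c + 1
  · by_cases hi : i < b + 1
    · rw [coeff_coeff_polyOfCoeffs γ (⟨i, hi⟩, ⟨j, hj⟩)]
      exact hW _
    · have hi' := ((bidegreeLE_polyOfCoeffs γ).natDegree_coeff_le j).trans_lt (by omega : b < i)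
      simpa [coeff_eq_zero_of_natDegree_lt hi']
  · have hj' := (bidegreeLE_polyOfCoeffs γ).natDegree_le.trans_lt (by omega : c < j)
    simpa [coeff_eq_zero_of_natDegree_lt hj']

end Box

/-- The image of an integral polynomial in `A[X][Y]`. -/
noncomputable abbrev baseChange (A : Type*) [CommRing A] (F : ℤ[X][Y]) : A[X][Y] :=
  F.map (mapRingHom (Int.castRingHom A))

section Bihomogeneous

variable {b c : ℕ} {P : Fin 2 → ℚ} {H : ℝ}

theorem abs_num_le_of_ratHeight_le {n : ℕ} {P : Fin n → ℚ} (hP : (ratHeight P : ℝ) ≤ H)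
    (j : Fin n) : |((P j).num : ℝ)| ≤ H := by
  have h : (P j).num.natAbs ≤ ratHeight P :=
    (le_max_left _ _).trans (Finset.le_sup (f := fun j => max (P j).num.natAbs (P j).den)
      (Finset.mem_univ j))
  rw [← Int.cast_abs, Int.abs_eq_natAbs]
  exact le_trans (by exact_mod_cast h) hP

theorem den_le_of_ratHeight_le {n : ℕ} {P : Fin n → ℚ} (hP : (ratHeight P : ℝ) ≤ H)
    (j : Fin n) : ((P j).den : ℝ) ≤ H := by
  have h : (P j).den ≤ ratHeight P :=
    (le_max_right _ _).trans (Finset.le_sup (f := fun j => max (P j).num.natAbs (P j).den)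
      (Finset.mem_univ j))
  exact le_trans (by exact_mod_cast h) hP

/-- The integer `u ^ i * v ^ (b - i) * (s ^ j * t ^ (c - j))`, where `P = (u / v, s / t)` in lowest
terms and `a = (i, j)`: the monomial of bidegree `(b, c)` at the corresponding point of
`ℙ¹ × ℙ¹`. -/
def bihomMonomial (b c : ℕ) (P : Fin 2 → ℚ) (a : Box b c) : ℤ :=
  (P 0).num ^ (a.1 : ℕ) * (P 0).den ^ (b - a.1) * ((P 1).num ^ (a.2 : ℕ) * (P 1).den ^ (c - a.2))

/-- The bihomogenization of `f` in bidegree `(b, c)`, evaluated at the numerators and denominators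
of the coordinates of `P`. -/
noncomputable def bihomEval {R : Type*} [CommRing R] (f : R[X][Y]) (b c : ℕ) (P : Fin 2 → ℚ) : R :=
  (fun a : Box b c => (f.coeff a.2).coeff a.1) ⬝ᵥ fun a => (bihomMonomial b c P a : R)

theorem intCast_bihomMonomial {R : Type*} [CommRing R] {x y : R}
    (hx : x * (P 0).den = (P 0).num) (hy : y * (P 1).den = (P 1).num) (a : Box b c) :
    (bihomMonomial b c P a : R) =
      (P 0).den ^ b * (P 1).den ^ c * (x ^ (a.1 : ℕ) * y ^ (a.2 : ℕ)) := by
  have hcancel {z u v : R} (h : z * v = u) {i n : ℕ} (hi : i ≤ n) :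
      u ^ i * v ^ (n - i) = v ^ n * z ^ i := by
    rw [← h, mul_pow, mul_assoc, ← pow_add, Nat.add_sub_cancel' hi, mul_comm]
  rw [bihomMonomial]
  push_cast
  rw [hcancel hx (Nat.lt_succ_iff.1 a.1.2), hcancel hy (Nat.lt_succ_iff.1 a.2.2)]
  ring

theorem abs_bihomMonomial_le (hP : (ratHeight P : ℝ) ≤ H) (a : Box b c) :
    |(bihomMonomial b c P a : ℝ)| ≤ H ^ (b + c) := by
  have hH : 0 ≤ H := (Nat.cast_nonneg _).trans hP
  have hfactor (j : Fin 2) {i n : ℕ} (hi : i ≤ n) :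
      |((P j).num : ℝ)| ^ i * ((P j).den : ℝ) ^ (n - i) ≤ H ^ n := by
    rw [← Nat.add_sub_cancel' hi, pow_add, Nat.add_sub_cancel_left]
    gcongr
    exacts [abs_num_le_of_ratHeight_le hP j, den_le_of_ratHeight_le hP j]
  rw [bihomMonomial]
  push_cast
  simp only [abs_mul, abs_pow, Nat.abs_cast, pow_add]
  exact mul_le_mul (hfactor 0 (Nat.lt_succ_iff.1 a.1.2)) (hfactor 1 (Nat.lt_succ_iff.1 a.2.2))
    (by positivity) (by positivity)

theorem bihomEval_eq_mul_evalEval {R : Type*} [CommRing R] {f : R[X][Y]} (hf : BidegreeLE f b c)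
    {x y : R} (hx : x * (P 0).den = (P 0).num) (hy : y * (P 1).den = (P 1).num) :
    bihomEval f b c P = (P 0).den ^ b * (P 1).den ^ c * f.evalEval x y := by
  rw [bihomEval, hf.evalEval_eq_sum, dotProduct, Finset.mul_sum]
  refine Finset.sum_congr rfl fun a _ => ?_
  rw [intCast_bihomMonomial hx hy]
  ring

theorem bihomEval_eq_zero_iff {R : Type*} [CommRing R] [IsDomain R] [CharZero R] {f : R[X][Y]}
    (hf : BidegreeLE f b c) {x y : R} (hx : x * (P 0).den = (P 0).num)
    (hy : y * (P 1).den = (P 1).num) : bihomEval f b c P = 0 ↔ f.evalEval x y = 0 := by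
  rw [bihomEval_eq_mul_evalEval hf hx hy]
  simp [(P 0).den_ne_zero, (P 1).den_ne_zero]

theorem intCast_bihomEval {A : Type*} [CommRing A] (F : ℤ[X][Y]) :
    ((bihomEval F b c P : ℤ) : A) = bihomEval (baseChange A F) b c P := by
  simp [bihomEval, dotProduct]

theorem ratCast_mul_den (K : Type*) [Field K] [CharZero K] (q : ℚ) : (q : K) * q.den = q.num := by
  exact_mod_cast congrArg (fun r : ℚ => (r : K)) q.mul_den_eq_num

theorem bihomEval_real_eq_zero_iff {f : ℝ[X][Y]} (hf : BidegreeLE f b c) :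
    bihomEval f b c P = 0 ↔ f.evalEval (P 0 : ℝ) (P 1 : ℝ) = 0 :=
  bihomEval_eq_zero_iff hf (ratCast_mul_den ℝ _) (ratCast_mul_den ℝ _)

theorem bihomEval_int_eq_zero_iff {F : ℤ[X][Y]} (hF : BidegreeLE F b c) :
    bihomEval F b c P = 0 ↔ (baseChange ℝ F).evalEval (P 0 : ℝ) (P 1 : ℝ) = 0 := by
  rw [← bihomEval_real_eq_zero_iff (hF.map _), ← intCast_bihomEval, Int.cast_eq_zero]

theorem abs_bihomEval_le {F : ℤ[X][Y]} {W : ℝ} (hW : ∀ i j, |((F.coeff j).coeff i : ℝ)| ≤ W)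
    (hP : (ratHeight P : ℝ) ≤ H) :
    |((bihomEval F b c P : ℤ) : ℝ)| ≤ (b + 1) * (c + 1) * (W * H ^ (b + c)) := by
  have hW0 : 0 ≤ W := (abs_nonneg _).trans (hW 0 0)
  rw [bihomEval, dotProduct, Int.cast_sum]
  calc _ ≤ _ := Finset.abs_sum_le_sum_abs _ _
    _ ≤ ∑ _a : Box b c, W * H ^ (b + c) := Finset.sum_le_sum fun a _ => by
        rw [Int.cast_id, Int.cast_mul, abs_mul]
        exact mul_le_mul (hW _ _) (abs_bihomMonomial_le hP a) (abs_nonneg _) hW0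
    _ = _ := by simp

end Bihomogeneous

/-! ### Residue classes modulo `p ^ k` -/

section NilpotentKernel

variable {A k : Type*} [CommRing A] [Field k] {π : A →+* k}

theorem card_simple_roots_le_natDegree (hπ : ∀ a, π a = 0 → IsNilpotent a) {r : A[X]}
    {T : Finset A} (h0 : ∀ y ∈ T, r.eval y = 0) (hu : ∀ y ∈ T, IsUnit (r.derivative.eval y)) :
    T.card ≤ r.natDegree := by
  classical
  rcases T.eq_empty_or_nonempty with rfl | ⟨y₀, hy₀⟩
  · exact Nat.zero_le _
  have hmap : r.map π ≠ 0 := by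
    intro h
    have h' : (r.map π).derivative.eval (π y₀) = 0 := by rw [h, derivative_zero, eval_zero]
    rw [derivative_map, eval_map, eval₂_hom] at h'
    exact ((hu y₀ hy₀).map π).ne_zero h'
  have hinj : Set.InjOn π T := by
    intro y hy y' hy' h
    refine (existsUnique_nilpotent_sub_and_aeval_eq_zero (P := r) (x := y) ?_ ?_).unique
      ⟨by simp, ?_⟩ ⟨hπ _ ?_, ?_⟩
    · simp [coe_aeval_eq_eval, h0 y hy]
    · simpa [coe_aeval_eq_eval] using hu y hy
    · simpa [coe_aeval_eq_eval] using h0 y hy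
    · rw [map_sub, h, sub_self]
    · simpa [coe_aeval_eq_eval] using h0 y' hy'
  rw [← Finset.card_image_of_injOn hinj]
  refine (card_le_degree_of_subset_roots (p := r.map π) fun z hz => ?_).trans natDegree_map_le
  obtain ⟨y, hy, rfl⟩ := Finset.mem_image.1 hz
  rw [mem_roots hmap, IsRoot, eval_map, eval₂_hom, h0 y hy, map_zero]

theorem card_smooth_zeros_le [Fintype A] (hπ : ∀ a, π a = 0 → IsNilpotent a) {g : A[X][Y]}
    {S : Finset (A × A)} (h0 : ∀ P ∈ S, g.evalEval P.1 P.2 = 0)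
    (hu : ∀ P ∈ S, IsUnit (g.derivative.evalEval P.1 P.2)) :
    S.card ≤ g.natDegree * Fintype.card A := by
  classical
  have hfibre (x : A) (T : Finset A) (hT : ∀ y ∈ T, (x, y) ∈ S) : T.card ≤ g.natDegree := by
    refine (card_simple_roots_le_natDegree hπ (r := g.map (evalRingHom x)) (fun y hy => ?_)
      fun y hy => ?_).trans natDegree_map_le
    · rw [map_evalRingHom_eval, h0 _ (hT y hy)]
    · rw [derivative_map, map_evalRingHom_eval]
      exact hu _ (hT y hy)
  calc S.card ≤ g.natDegree * (S.image Prod.fst).card :=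
        card_le_mul_card_image_fst hfibre
    _ ≤ g.natDegree * Fintype.card A := by gcongr; exact Finset.card_le_univ _

theorem isNilpotent_of_castHom_eq_zero {p k : ℕ} [NeZero p] (hk : k ≠ 0) (a : ZMod (p ^ k))
    (ha : ZMod.castHom (dvd_pow_self p hk) (ZMod p) a = 0) : IsNilpotent a := by
  refine ⟨k, ?_⟩
  rw [← ZMod.natCast_zmod_val a] at ha ⊢
  rw [map_natCast, ZMod.natCast_eq_zero_iff] at ha
  rw [← Nat.cast_pow, ZMod.natCast_eq_zero_iff]
  exact pow_dvd_pow_of_dvd ha k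

end NilpotentKernel

/-- The point `P` has no denominator divisible by `p`, and on the curve `F = 0` its reduction
modulo `p` is a point at which the `Y`-derivative of `F` does not vanish. -/
structure IsGoodAt (F : ℤ[X][Y]) (b c p : ℕ) (P : Fin 2 → ℚ) : Prop where
  not_dvd_den : ∀ j, ¬ p ∣ (P j).den
  bihomEval_eq_zero : bihomEval F b c P = 0
  not_dvd_derivative : ¬ (p : ℤ) ∣ bihomEval (derivative F) b (c - 1) P

section GoodReduction

variable {p : ℕ} [Fact p.Prime]

theorem isUnit_intCast_of_not_dvd {n : ℤ} (hn : ¬ (p : ℤ) ∣ n) : IsUnit (n : ℤ_[p]) := by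
  rw [PadicInt.isUnit_iff]
  exact le_antisymm (PadicInt.norm_le_one _)
    (not_lt.1 fun h => hn ((PadicInt.norm_int_lt_one_iff_dvd n).1 h))

variable (p) in
/-- The rational number `q` as a `p`-adic integer; the junk value `0` if `p` divides the
denominator. -/
noncomputable def padicPart (q : ℚ) : ℤ_[p] := q.num * Ring.inverse (q.den : ℤ_[p])

theorem padicPart_mul_den {q : ℚ} (hq : ¬ p ∣ q.den) :
    padicPart p q * (q.den : ℤ_[p]) = (q.num : ℤ_[p]) := by
  have hden : IsUnit (q.den : ℤ_[p]) := by
    simpa using isUnit_intCast_of_not_dvd (mt Int.natCast_dvd_natCast.1 hq)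
  rw [padicPart, mul_assoc, Ring.inverse_mul_cancel _ hden, mul_one]

variable (p) in
/-- The reduction of `P` modulo `p ^ k`, meaningful if `p` divides no denominator of `P`. -/
noncomputable def residueClass (k : ℕ) (P : Fin 2 → ℚ) : ZMod (p ^ k) × ZMod (p ^ k) :=
  (PadicInt.toZModPow k (padicPart p (P 0)), PadicInt.toZModPow k (padicPart p (P 1)))

theorem pow_dvd_sub_of_toZModPow_eq {k : ℕ} {ξ η : ℤ_[p]}
    (h : PadicInt.toZModPow k ξ = PadicInt.toZModPow k η) : (p : ℤ_[p]) ^ k ∣ ξ - η := by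
  rw [← Ideal.mem_span_singleton, ← PadicInt.ker_toZModPow, RingHom.mem_ker, map_sub, h, sub_self]

namespace IsGoodAt

variable {F : ℤ[X][Y]} {b c k : ℕ} {P : Fin 2 → ℚ}

theorem evalEval_eq_zero (hP : IsGoodAt F b c p P) (hF : BidegreeLE F b c) :
    (baseChange ℤ_[p] F).evalEval (padicPart p (P 0)) (padicPart p (P 1)) = 0 := by
  rw [← bihomEval_eq_zero_iff (hF.map _) (padicPart_mul_den (hP.not_dvd_den 0))
    (padicPart_mul_den (hP.not_dvd_den 1)), ← intCast_bihomEval, hP.bihomEval_eq_zero,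
    Int.cast_zero]

theorem isUnit_evalEval_derivative (hP : IsGoodAt F b c p P) (hF : BidegreeLE F b c) :
    IsUnit ((baseChange ℤ_[p] F).derivative.evalEval (padicPart p (P 0)) (padicPart p (P 1))) := by
  have hu := isUnit_intCast_of_not_dvd hP.not_dvd_derivative
  rw [intCast_bihomEval, bihomEval_eq_mul_evalEval (hF.derivative.map _)
    (padicPart_mul_den (hP.not_dvd_den 0)) (padicPart_mul_den (hP.not_dvd_den 1))] at hu
  rw [derivative_map]
  exact isUnit_of_mul_isUnit_right hu

end IsGoodAt

variable {F : ℤ[X][Y]} {b c k m e : ℕ}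

theorem card_image_residueClass_le (hk : k ≠ 0) (hF : BidegreeLE F b c) {S : Finset (Fin 2 → ℚ)}
    (hgood : ∀ P ∈ S, IsGoodAt F b c p P) : (S.image (residueClass p k)).card ≤ c * p ^ k := by
  have : NeZero p := ⟨(Fact.out : p.Prime).ne_zero⟩
  let φ : ℤ_[p] →+* ZMod (p ^ k) := PadicInt.toZModPow k
  let G : (ZMod (p ^ k))[X][Y] := (baseChange ℤ_[p] F).map (mapRingHom φ)
  have hcard : (S.image (residueClass p k)).card ≤ G.natDegree * Fintype.card (ZMod (p ^ k)) := by
    refine card_smooth_zeros_le (isNilpotent_of_castHom_eq_zero hk) ?_ ?_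
    all_goals
      intro a ha
      obtain ⟨P, hP, rfl⟩ := Finset.mem_image.1 ha
    · exact (map_mapRingHom_evalEval φ _ _ _).trans
        (by rw [(hgood P hP).evalEval_eq_zero hF, map_zero])
    · rw [derivative_map]
      exact map_mapRingHom_evalEval φ _ _ _ ▸ ((hgood P hP).isUnit_evalEval_derivative hF).map φ
  refine hcard.trans ?_
  rw [ZMod.card]
  gcongr
  exact natDegree_map_le.trans (hF.map _).natDegree_le

theorem pow_dvd_det_bihomMonomial (hF : BidegreeLE F b c) {r : Box m e → Fin 2 → ℚ}
    (hgood : ∀ i, IsGoodAt F b c p (r i))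
    (hclass : ∀ i j, residueClass p k (r i) = residueClass p k (r j)) :
    (p : ℤ) ^ (k * ((m + 1) * (e + 1)).choose 2) ∣
      (Matrix.of fun i => bihomMonomial m e (r i)).det := by
  have hdvd := pow_dvd_det_monomials ((hgood 0).evalEval_eq_zero hF)
    ((hgood 0).isUnit_evalEval_derivative hF)
    (fun i => pow_dvd_sub_of_toZModPow_eq (congrArg Prod.fst (hclass i 0)))
    (fun i => pow_dvd_sub_of_toZModPow_eq (congrArg Prod.snd (hclass i 0)))
    (fun i => (hgood i).evalEval_eq_zero hF) (fun a : Box m e => ((a.1 : ℕ), (a.2 : ℕ)))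
  have hcast : ((Matrix.of fun i => bihomMonomial m e (r i)).det : ℤ_[p]) =
      (∏ i, ((r i 0).den : ℤ_[p]) ^ m * ((r i 1).den : ℤ_[p]) ^ e) *
        (Matrix.of fun i (a : Box m e) =>
          padicPart p (r i 0) ^ (a.1 : ℕ) * padicPart p (r i 1) ^ (a.2 : ℕ)).det := by
    rw [← Matrix.det_mul_column, Int.cast_det]
    congr 1
    ext i a
    rw [Matrix.map_apply, Matrix.of_apply, Matrix.of_apply, Matrix.of_apply,
      intCast_bihomMonomial (padicPart_mul_den ((hgood i).not_dvd_den 0))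
        (padicPart_mul_den ((hgood i).not_dvd_den 1))]
  rw [← PadicInt.pow_p_dvd_int_iff, hcast, pow_mul]
  simpa using hdvd.mul_left _

theorem abs_det_bihomMonomial_le {r : Box m e → Fin 2 → ℚ} {H : ℝ}
    (hr : ∀ i, (ratHeight (r i) : ℝ) ≤ H) :
    |((Matrix.of fun i => bihomMonomial m e (r i)).det : ℝ)| ≤
      ((m + 1) * (e + 1)).factorial * (H ^ (m + e)) ^ ((m + 1) * (e + 1)) := by
  rw [Int.cast_det]
  simpa using Matrix.det_le (abv := AbsoluteValue.abs)
    (A := (Matrix.of fun i => bihomMonomial m e (r i)).map (Int.cast : ℤ → ℝ))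
    fun i a => abs_bihomMonomial_le (hr i) a

/-- The determinant method: `hbig` says that the `p`-adic divisibility of the determinants of
monomials exceeds their archimedean size. -/
theorem exists_auxiliary_polynomial (hF : BidegreeLE F b c) {H : ℝ}
    (hbig : ((m + 1) * (e + 1)).factorial * (H ^ (m + e)) ^ ((m + 1) * (e + 1)) <
      (p : ℝ) ^ (k * ((m + 1) * (e + 1)).choose 2))
    {T : Set (Fin 2 → ℚ)} (hT : ∀ P ∈ T, (ratHeight P : ℝ) ≤ H)
    (hgood : ∀ P ∈ T, IsGoodAt F b c p P)
    (hclass : ∀ P ∈ T, ∀ Q ∈ T, residueClass p k P = residueClass p k Q) :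
    ∃ g : ℝ[X][Y], g ≠ 0 ∧ BidegreeLE g m e ∧
      ∀ P ∈ T, g.evalEval (P 0 : ℝ) (P 1 : ℝ) = 0 := by
  have hdet (r : Box m e → Fin 2 → ℚ) (hr : ∀ i, r i ∈ T) :
      (Matrix.of fun i => bihomMonomial m e (r i)).det = 0 := by
    have hdvd := pow_dvd_det_bihomMonomial (m := m) (e := e) (r := r) hF
      (fun i => hgood _ (hr i)) fun i j => hclass _ (hr i) _ (hr j)
    have hlt := (abs_det_bihomMonomial_le fun i => hT _ (hr i)).trans_lt hbig
    exact Int.eq_zero_of_abs_lt_dvd hdvd (by exact_mod_cast hlt)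
  obtain ⟨γ, hγ, hrel⟩ := exists_dotProduct_eq_zero_of_det_eq_zero
    (s := (fun P a => (bihomMonomial m e P a : ℝ)) '' T) (by
      intro v hv
      choose r hrT hr using hv
      obtain rfl : (fun i a => (bihomMonomial m e (r i) a : ℝ)) = v := funext hr
      have h := congrArg (Int.cast : ℤ → ℝ) (hdet r hrT)
      rwa [Int.cast_det, Int.cast_zero] at h)
  refine ⟨polyOfCoeffs γ, polyOfCoeffs_ne_zero hγ, bidegreeLE_polyOfCoeffs γ, fun P hP => ?_⟩
  rw [← bihomEval_real_eq_zero_iff (bidegreeLE_polyOfCoeffs γ), bihomEval]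
  simpa only [coeff_coeff_polyOfCoeffs] using hrel _ (Set.mem_image_of_mem _ hP)

end GoodReduction

theorem card_le_of_evalEval_eq_zero {K : Type*} [Field K] [CharZero K] {f g : K[X][Y]}
    {b c m e : ℕ} (hf : Irreducible f)
    (hdeg : f.natDegree ≠ 0) (hfb : BidegreeLE f b c) (hgb : BidegreeLE g m e) (hg : ¬ f ∣ g)
    {S : Finset (Fin 2 → ℚ)} (hfS : ∀ P ∈ S, f.evalEval (P 0 : K) (P 1 : K) = 0)
    (hgS : ∀ P ∈ S, g.evalEval (P 0 : K) (P 1 : K) = 0) : S.card ≤ c * (b * e + m * c) := by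
  classical
  let ρ : (Fin 2 → ℚ) → K × K := fun P => (P 0, P 1)
  have hρ : Function.Injective ρ := by
    intro P Q h
    simp only [ρ, Prod.mk.injEq, Rat.cast_inj] at h
    exact funext (Fin.forall_fin_two.2 h)
  rw [← Finset.card_image_of_injective S hρ]
  exact card_common_zeros_le hf hdeg hfb hgb hg _
    (Finset.forall_mem_image.2 hfS) (Finset.forall_mem_image.2 hgS)

theorem card_good_points_le {F : ℤ[X][Y]} {b e p k m : ℕ} [Fact p.Prime] (hk : k ≠ 0)
    (hF : BidegreeLE F b (e + 1)) (hirr : Irreducible (baseChange ℝ F))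
    (hdeg : (baseChange ℝ F).natDegree = e + 1) {H : ℝ}
    (hbig : ((m + 1) * (e + 1)).factorial * (H ^ (m + e)) ^ ((m + 1) * (e + 1)) <
      (p : ℝ) ^ (k * ((m + 1) * (e + 1)).choose 2))
    {S : Finset (Fin 2 → ℚ)} (hS : ∀ P ∈ S, (ratHeight P : ℝ) ≤ H)
    (hgood : ∀ P ∈ S, IsGoodAt F b (e + 1) p P) :
    S.card ≤ (e + 1) * (b * e + m * (e + 1)) * ((e + 1) * p ^ k) := by
  classical
  have hfibre (a : ZMod (p ^ k) × ZMod (p ^ k)) :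
      (S.filter fun P => residueClass p k P = a).card ≤ (e + 1) * (b * e + m * (e + 1)) := by
    have hmem {P} (hP : P ∈ S.filter fun P => residueClass p k P = a) :
        P ∈ S ∧ residueClass p k P = a := Finset.mem_filter.1 hP
    obtain ⟨g, hg0, hgb, hgT⟩ := exists_auxiliary_polynomial hF hbig
      (T := ↑(S.filter fun P => residueClass p k P = a))
      (fun P hP => hS P (hmem hP).1) (fun P hP => hgood P (hmem hP).1)
      (fun P hP Q hQ => (hmem hP).2.trans (hmem hQ).2.symm)
    refine card_le_of_evalEval_eq_zero hirr (by omega) (hF.map _) hgb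
      (not_dvd_of_natDegree_lt hg0 (by have := hgb.natDegree_le; omega)) (fun P hP => ?_) hgT
    exact (bihomEval_int_eq_zero_iff hF).1 (hgood P (hmem hP).1).bihomEval_eq_zero
  calc S.card ≤ _ * (S.image (residueClass p k)).card :=
        Finset.card_le_mul_card_image S _ fun a _ => hfibre a
    _ ≤ _ := by gcongr; exact card_image_residueClass_le hk hF hgood

theorem exists_eq_C_C_of_bidegreeLE_mul {R : Type*} [CommRing R] [IsDomain R] {f q : R[X][Y]}
    {b c : ℕ} (hdeg : f.natDegree = c) (hb : ∃ j, f.coeff j ≠ 0 ∧ (f.coeff j).natDegree = b)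
    (h0 : f * q ≠ 0) (hfq : BidegreeLE (f * q) b c) : ∃ t : R, t ≠ 0 ∧ q = C (C t) := by
  have hq0 : q ≠ 0 := right_ne_zero_of_mul h0
  have hq : q.natDegree = 0 := by
    have h := hfq.natDegree_le
    rw [natDegree_mul (left_ne_zero_of_mul h0) hq0] at h
    omega
  obtain ⟨u, rfl⟩ := natDegree_eq_zero.1 hq
  obtain ⟨j, hj, hjb⟩ := hb
  have hu0 : u ≠ 0 := by rintro rfl; exact hq0 C_0
  have hu : u.natDegree = 0 := by
    have h := hfq.natDegree_coeff_le j
    rw [coeff_mul_C, natDegree_mul hj hu0] at h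
    omega
  obtain ⟨t, rfl⟩ := natDegree_eq_zero.1 hu
  exact ⟨t, by rintro rfl; exact hu0 C_0, rfl⟩

theorem exists_integer_equation {f : ℝ[X][Y]} {b c : ℕ} (hirr : Irreducible f)
    (hdeg : f.natDegree = c) (hc : c ≠ 0) (hfb : BidegreeLE f b c)
    (hb : ∃ j, f.coeff j ≠ 0 ∧ (f.coeff j).natDegree = b) {H : ℝ} (hH : 1 ≤ H)
    {S : Finset (Fin 2 → ℚ)} (hS : ∀ P ∈ S, (ratHeight P : ℝ) ≤ H)
    (h0 : ∀ P ∈ S, f.evalEval (P 0 : ℝ) (P 1 : ℝ) = 0) (hcard : c * (b * c + b * c) < S.card) :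
    ∃ F : ℤ[X][Y], BidegreeLE F b c ∧
      (∀ i j, |((F.coeff j).coeff i : ℝ)| ≤
        (((b + 1) * (c + 1) : ℕ) * H ^ (b + c)) ^ ((b + 1) * (c + 1) - 1)) ∧
      ∃ t : ℝ, t ≠ 0 ∧ baseChange ℝ F = f * C (C t) := by
  have hγ : (fun a : Box b c => (f.coeff a.2).coeff a.1) ≠ 0 := by
    obtain ⟨j, hj, hjb⟩ := hb
    have hjc : j < c + 1 := by
      have := le_natDegree_of_ne_zero hj
      omega
    intro h
    have hlead := congrFun h (⟨b, by omega⟩, ⟨j, hjc⟩)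
    simp [← hjb, hj] at hlead
  obtain ⟨w, hw0, hw, hwS⟩ := exists_small_int_dotProduct_eq_zero
    (s := bihomMonomial b c '' S) (one_le_pow₀ hH : 1 ≤ H ^ (b + c))
    (by rintro _ ⟨P, hP, rfl⟩; exact abs_bihomMonomial_le (hS P hP)) hγ
    (by rintro _ ⟨P, hP, rfl⟩; exact (bihomEval_real_eq_zero_iff hfb).2 (h0 P hP))
  have hcard_box : Fintype.card (Box b c) = (b + 1) * (c + 1) := by simp
  rw [hcard_box] at hw
  set F := polyOfCoeffs w
  have hF : BidegreeLE F b c := bidegreeLE_polyOfCoeffs w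
  have hF0 : baseChange ℝ F ≠ 0 :=
    (Polynomial.map_ne_zero_iff (map_injective _ Int.cast_injective)).2 (polyOfCoeffs_ne_zero hw0)
  have hdvd : f ∣ baseChange ℝ F := by
    by_contra hnd
    refine hcard.not_ge (card_le_of_evalEval_eq_zero hirr (by omega) hfb (hF.map _) hnd h0 ?_)
    intro P hP
    rw [← bihomEval_int_eq_zero_iff hF, bihomEval]
    simpa [F, coeff_coeff_polyOfCoeffs] using hwS _ (Set.mem_image_of_mem _ hP)
  obtain ⟨q, hq⟩ := hdvd
  obtain ⟨t, ht, rfl⟩ := exists_eq_C_C_of_bidegreeLE_mul hdeg hb (hq ▸ hF0) (hq ▸ hF.map _)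
  exact ⟨F, hF, abs_coeff_polyOfCoeffs_le hw, t, ht, hq⟩

/-! ### The choice of the prime and of the modulus -/

theorem log_le_add_fourth_root {x : ℝ} (hx : 0 < x) : Real.log x ≤ 4 + 4 / 5 * √√x := by
  have hs : 0 < √√x := by positivity
  have hlog5 : Real.log 5 ≤ 2 := by
    rw [Real.log_le_iff_le_exp (by norm_num), ← one_add_one_eq_two, Real.exp_add]
    nlinarith [Real.exp_one_gt_d9]
  have hlogs := Real.log_le_sub_one_of_pos (show 0 < √√x / 5 by positivity)
  rw [Real.log_div hs.ne' (by norm_num), Real.log_sqrt (by positivity), Real.log_sqrt hx.le]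
    at hlogs
  linarith

theorem quarter_le_theta {n : ℕ} (hn : 9000 ≤ n) : (n : ℝ) / 4 ≤ Chebyshev.theta n := by
  have hn' : (9000 : ℝ) ≤ n := by exact_mod_cast hn
  have hlog := log_le_add_fourth_root (show (0 : ℝ) < n by linarith)
  have htheta := Chebyshev.theta_ge n
  set s : ℝ := √√(n : ℝ)
  have hs2 : √(n : ℝ) = s ^ 2 := (Real.sq_sqrt (Real.sqrt_nonneg _)).symm
  have hs4 : (n : ℝ) = s ^ 4 := by
    rw [show s ^ 4 = (s ^ 2) ^ 2 by ring, ← hs2, Real.sq_sqrt (by positivity)]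
  have hs : (9.7 : ℝ) ≤ s :=
    le_of_pow_le_pow_left₀ four_ne_zero (Real.sqrt_nonneg _) (by rw [← hs4]; linarith)
  have hlog_succ : Real.log (n + 1) ≤ 5 + 4 / 5 * s := by
    have h : Real.log (n + 1) ≤ Real.log (2 * n) := Real.log_le_log (by linarith) (by linarith)
    rw [Real.log_mul (by norm_num) (by linarith)] at h
    linarith [Real.log_two_lt_d9]
  have hmain : 2 * s ^ 2 * Real.log n ≤ 2 * s ^ 2 * (4 + 4 / 5 * s) := by gcongr
  have herror : 2 * s ^ 2 * (4 + 4 / 5 * s) + (5 + 4 / 5 * s) ≤ 0.4 * s ^ 4 := by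
    have h1 : s ^ 2 * (8 / 5 * s + 8) ≤ s ^ 2 * (0.26 * s ^ 2) := by gcongr; nlinarith
    have h2 : 5 + 4 / 5 * s ≤ 0.14 * s ^ 2 := by nlinarith
    have h3 : s ^ 2 ≤ s ^ 4 := pow_le_pow_right₀ (by linarith) (by norm_num)
    linarith
  rw [hs2] at htheta
  rw [← hs4] at herror
  nlinarith [Real.log_two_gt_d9]

theorem exists_prime_not_dvd {N : ℤ} (hN : N ≠ 0) {n : ℕ} (hn : 9000 ≤ n)
    (hlog : Real.log |(N : ℝ)| < n / 4) : ∃ p, p.Prime ∧ p ≤ n ∧ ¬ (p : ℤ) ∣ N := by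
  by_contra! hall
  have hdvd : primorial n ∣ N.natAbs := by
    rw [primorial_eq_prod_primesLE]
    refine Finset.prod_primes_dvd _ (fun p hp => (Nat.prime_of_mem_primesLE hp).prime)
      fun p hp => ?_
    exact Int.natCast_dvd.1 (hall p (Nat.prime_of_mem_primesLE hp) (Nat.le_of_mem_primesLE hp))
  have hle : Real.log (primorial n) ≤ Real.log |(N : ℝ)| := by
    refine Real.log_le_log (by exact_mod_cast primorial_pos n) ?_
    rw [← Int.cast_abs, Int.abs_eq_natAbs]
    exact_mod_cast Nat.le_of_dvd (Int.natAbs_pos.2 hN) hdvd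
  have htheta := quarter_le_theta hn
  rw [Chebyshev.theta_eq_log_primorial, Nat.floor_natCast] at htheta
  linarith

theorem natCast_sq_le_four_pow {D : ℕ} (hD : D ≠ 0) : (D : ℝ) ^ 2 ≤ 4 ^ (D - 1) := by
  have h : D ≤ 2 ^ (D - 1) := by
    have := Nat.lt_two_pow_self (n := D - 1)
    omega
  calc (D : ℝ) ^ 2 ≤ (2 ^ (D - 1)) ^ 2 := by gcongr; exact_mod_cast h
    _ = 4 ^ (D - 1) := by rw [pow_right_comm]; norm_num

theorem factorial_mul_pow_lt_pow_choose_two {D : ℕ} (hD : 2 ≤ D) {x Z q : ℝ} (hx : 0 ≤ x)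
    (hZ : 0 ≤ Z) (hxZ : (D : ℝ) ^ 2 * x ^ 2 ≤ Z ^ (D - 1)) (hZq : Z < q) :
    D.factorial * x ^ D < q ^ D.choose 2 := by
  have hchoose : D.choose 2 * 2 = (D - 1) * D := by
    rw [Nat.choose_two_right, Nat.div_mul_cancel D.even_mul_pred_self.two_dvd, mul_comm]
  refine lt_of_pow_lt_pow_left₀ 2 (pow_nonneg (hZ.trans hZq.le) _) ?_
  calc (D.factorial * x ^ D) ^ 2 ≤ ((D : ℝ) ^ D * x ^ D) ^ 2 := by
        gcongr
        exact_mod_cast Nat.factorial_le_pow D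
    _ = ((D : ℝ) ^ 2 * x ^ 2) ^ D := by ring
    _ ≤ (Z ^ (D - 1)) ^ D := by gcongr
    _ = Z ^ ((D - 1) * D) := (pow_mul ..).symm
    _ < q ^ ((D - 1) * D) := pow_lt_pow_left₀ hZq hZ (by simp; omega)
    _ = (q ^ D.choose 2) ^ 2 := by rw [← hchoose, pow_mul]

theorem pow_sq_le_exp_mul_rpow_pow {d m : ℕ} (hd : 2 ≤ d) {H : ℝ} (hH : 1 ≤ H)
    (hm : Real.log H ≤ m + 1) :
    (H ^ (m + (d - 1))) ^ 2 ≤ (Real.exp 2 * H ^ (2 / (d : ℝ))) ^ ((m + 1) * d - 1) := by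
  have hd' : (2 : ℝ) ≤ d := by exact_mod_cast hd
  have hD : 1 ≤ (m + 1) * d := by nlinarith
  set B := Real.log H
  have hB : 0 ≤ B := Real.log_nonneg hH
  have hHB : H = Real.exp B := (Real.exp_log (by linarith)).symm
  rw [hHB, ← Real.exp_mul, ← Real.exp_add, ← Real.exp_nat_mul, ← Real.exp_nat_mul,
    ← Real.exp_nat_mul, Real.exp_le_exp]
  push_cast [Nat.cast_sub (one_le_two.trans hd), Nat.cast_sub hD]
  have hBd : B * (2 / d) ≤ B := mul_le_of_le_one_right hB ((div_le_one (by linarith)).2 hd')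
  have hexpand : (((m : ℝ) + 1) * d - 1) * (2 + B * (2 / d)) =
      2 * (m + 1) * d + 2 * (m + 1) * B - 2 - B * (2 / d) := by field_simp; ring
  have hslack : 0 ≤ ((m : ℝ) + 1 - B) * (d - 1) := mul_nonneg (by linarith) (by linarith)
  nlinarith

theorem sq_mul_pow_sq_le {d m : ℕ} (hd : 2 ≤ d) {H : ℝ} (hH : 1 ≤ H)
    (hm : Real.log H ≤ m + 1) :
    (((m + 1) * d : ℕ) : ℝ) ^ 2 * (H ^ (m + (d - 1))) ^ 2 ≤
      (30 * H ^ (2 / (d : ℝ))) ^ ((m + 1) * d - 1) := by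
  have hexp : Real.exp 2 ≤ 7.5 := by
    rw [← one_add_one_eq_two, Real.exp_add]
    nlinarith [Real.exp_one_lt_d9, Real.exp_pos 1]
  calc (((m + 1) * d : ℕ) : ℝ) ^ 2 * (H ^ (m + (d - 1))) ^ 2
      ≤ 4 ^ ((m + 1) * d - 1) * (Real.exp 2 * H ^ (2 / (d : ℝ))) ^ ((m + 1) * d - 1) := by
        gcongr
        · exact natCast_sq_le_four_pow (by simp; omega)
        · exact pow_sq_le_exp_mul_rpow_pow hd hH hm
    _ = (4 * Real.exp 2 * H ^ (2 / (d : ℝ))) ^ ((m + 1) * d - 1) := by rw [← mul_pow, mul_assoc]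
    _ ≤ (30 * H ^ (2 / (d : ℝ))) ^ ((m + 1) * d - 1) := by gcongr; linarith

theorem exists_modulus_exponent {p d m : ℕ} (hp : 2 ≤ p) (hd : 2 ≤ d) {H : ℝ} (hH : 1 ≤ H)
    (hm : Real.log H ≤ m + 1) :
    ∃ k, k ≠ 0 ∧
      (((m + 1) * d).factorial : ℝ) * (H ^ (m + (d - 1))) ^ ((m + 1) * d) <
        (p : ℝ) ^ (k * ((m + 1) * d).choose 2) ∧
      (p : ℝ) ^ k ≤ 30 * H ^ (2 / (d : ℝ)) * p := by
  have hp' : (1 : ℝ) < p := by exact_mod_cast hp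
  have hZ : 1 ≤ 30 * H ^ (2 / (d : ℝ)) := by
    linarith [Real.one_le_rpow hH (show 0 ≤ 2 / (d : ℝ) by positivity)]
  obtain ⟨n, hpow, hlt⟩ := exists_nat_pow_near hZ hp'
  refine ⟨n + 1, n.succ_ne_zero, ?_, by rw [pow_succ]; gcongr⟩
  rw [pow_mul (p : ℝ) (n + 1)]
  exact factorial_mul_pow_lt_pow_choose_two (by nlinarith) (by positivity) (by linarith)
    (sq_mul_pow_sq_le hd hH hm) hlt

theorem natCast_add_one_le_pow {H : ℝ} (hH : Real.exp 1 ≤ H) (d : ℕ) : (d : ℝ) + 1 ≤ H ^ d := by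
  calc (d : ℝ) + 1 ≤ Real.exp d := Real.add_one_le_exp _
    _ = Real.exp 1 ^ d := by rw [← Real.exp_nat_mul, mul_one]
    _ ≤ H ^ d := by gcongr

theorem siegel_bound_le_pow {b d : ℕ} (hd : 2 ≤ d) (hbd : b ≤ d) {H : ℝ} (hH : Real.exp 1 ≤ H) :
    (((b + 1) * (d + 1) : ℕ) * H ^ (b + d)) ^ ((b + 1) * (d + 1) - 1) ≤ H ^ (8 * d ^ 3) := by
  have hH1 : 1 ≤ H := (Real.one_le_exp zero_le_one).trans hH
  have hcast : ((b + 1) * (d + 1) : ℕ) * H ^ (b + d) ≤ H ^ (4 * d) := by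
    have hd1 : ((d + 1 : ℕ) : ℝ) ≤ H ^ d := by exact_mod_cast natCast_add_one_le_pow hH d
    have hb1 : ((b + 1 : ℕ) : ℝ) ≤ H ^ d := le_trans (by exact_mod_cast Nat.succ_le_succ hbd) hd1
    calc ((b + 1) * (d + 1) : ℕ) * H ^ (b + d) ≤ (H ^ d * H ^ d) * H ^ (d + d) := by
          rw [Nat.cast_mul]; gcongr
      _ = H ^ (4 * d) := by ring
  have hexp : (b + 1) * (d + 1) - 1 ≤ 2 * d ^ 2 := by
    have : (b + 1) * (d + 1) ≤ (d + 1) * (d + 1) := by gcongr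
    have : (d + 1) * (d + 1) ≤ 2 * d ^ 2 + 1 := by nlinarith
    omega
  calc _ ≤ (H ^ (4 * d)) ^ ((b + 1) * (d + 1) - 1) := by gcongr
    _ ≤ (H ^ (4 * d)) ^ (2 * d ^ 2) := pow_le_pow_right₀ (one_le_pow₀ hH1) hexp
    _ = H ^ (8 * d ^ 3) := by ring

theorem abs_coeff_derivative_le {F : ℤ[X][Y]} {b c : ℕ} (hF : BidegreeLE F b c) {W : ℝ}
    (hW : ∀ i j, |((F.coeff j).coeff i : ℝ)| ≤ W) (i j : ℕ) :
    |(((derivative F).coeff j).coeff i : ℝ)| ≤ c * W := by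
  have hW0 : 0 ≤ W := (abs_nonneg _).trans (hW 0 0)
  rw [coeff_derivative, show ((j : ℤ[X]) + 1) = C ((j : ℤ) + 1) by simp, coeff_mul_C]
  by_cases hj : j + 1 ≤ c
  · push_cast
    rw [abs_mul, mul_comm, abs_of_nonneg (show (0 : ℝ) ≤ (j : ℝ) + 1 by positivity)]
    gcongr
    · exact_mod_cast hj
    · exact hW _ _
  · rw [coeff_eq_zero_of_natDegree_lt (hF.natDegree_le.trans_lt (by omega))]
    simp only [coeff_zero, zero_mul, Int.cast_zero, abs_zero]
    positivity

theorem abs_dens_mul_bihomEval_derivative_le {F : ℤ[X][Y]} {b d : ℕ} (hd : 2 ≤ d) (hbd : b ≤ d)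
    (hF : BidegreeLE F b d) {H : ℝ} (hH : Real.exp 1 ≤ H)
    (hW : ∀ i j, |((F.coeff j).coeff i : ℝ)| ≤ H ^ (8 * d ^ 3)) {P : Fin 2 → ℚ}
    (hP : (ratHeight P : ℝ) ≤ H) :
    |(((P 0).den * (P 1).den * bihomEval (derivative F) b (d - 1) P : ℤ) : ℝ)| ≤
      H ^ (10 * d ^ 3) := by
  have hH1 : 1 ≤ H := (Real.one_le_exp zero_le_one).trans hH
  have hd1 := natCast_add_one_le_pow hH d
  have hbd' : (b : ℝ) ≤ d := by exact_mod_cast hbd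
  have hpred : ((d - 1 : ℕ) : ℝ) ≤ d := by exact_mod_cast Nat.sub_le d 1
  have hhom := abs_bihomEval_le (b := b) (c := d - 1) (abs_coeff_derivative_le hF hW) hP
  have hexp : 2 + 5 * d + 8 * d ^ 3 ≤ 10 * d ^ 3 := by
    have : 4 * d ≤ d ^ 3 := by
      calc 4 * d ≤ d ^ 2 * d := by gcongr; nlinarith
        _ = d ^ 3 := by ring
    omega
  push_cast
  rw [abs_mul, abs_mul, Nat.abs_cast, Nat.abs_cast]
  calc _ ≤ H * H * ((b + 1) * ((d - 1 : ℕ) + 1) * (d * H ^ (8 * d ^ 3) * H ^ (b + (d - 1)))) := by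
        gcongr
        · exact den_le_of_ratHeight_le hP 0
        · exact den_le_of_ratHeight_le hP 1
    _ ≤ H * H * (H ^ d * H ^ d * (H ^ d * H ^ (8 * d ^ 3) * H ^ (d + d))) := by
        gcongr <;> first | linarith | omega
    _ = H ^ (2 + 5 * d + 8 * d ^ 3) := by ring
    _ ≤ H ^ (10 * d ^ 3) := pow_le_pow_right₀ hH1 hexp

theorem exists_isGoodAt {F : ℤ[X][Y]} {b d : ℕ} (hd : 2 ≤ d) (hbd : b ≤ d)
    (hF : BidegreeLE F b d) {H : ℝ} (hH : Real.exp 1 ≤ H)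
    (hW : ∀ i j, |((F.coeff j).coeff i : ℝ)| ≤ H ^ (8 * d ^ 3)) {P : Fin 2 → ℚ}
    (hP : (ratHeight P : ℝ) ≤ H) (h0 : bihomEval F b d P = 0)
    (hne : bihomEval (derivative F) b (d - 1) P ≠ 0) {n : ℕ} (hn : 9000 ≤ n)
    (hlog : 10 * d ^ 3 * Real.log H < n / 4) :
    ∃ p, p.Prime ∧ p ≤ n ∧ IsGoodAt F b d p P := by
  set N : ℤ := (P 0).den * (P 1).den * bihomEval (derivative F) b (d - 1) P
  have hN0 : N ≠ 0 := mul_ne_zero (by simp) hne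
  have hNlog : Real.log |(N : ℝ)| < n / 4 := by
    refine lt_of_le_of_lt ?_ hlog
    have h := Real.log_le_log (abs_pos.2 (Int.cast_ne_zero.2 hN0))
      (abs_dens_mul_bihomEval_derivative_le hd hbd hF hH hW hP)
    rw [Real.log_pow] at h
    exact_mod_cast h
  obtain ⟨p, hp, hpn, hdvd⟩ := exists_prime_not_dvd hN0 hn hNlog
  refine ⟨p, hp, hpn, Fin.forall_fin_two.2 ⟨fun h => hdvd ?_, fun h => hdvd ?_⟩, h0,
    fun h => hdvd (h.mul_left _)⟩
  · exact ((Int.natCast_dvd_natCast.2 h).mul_right _).mul_right _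
  · exact ((Int.natCast_dvd_natCast.2 h).mul_left _).mul_right _

/-! ### Counting points -/

theorem one_le_log {H : ℝ} (hH : Real.exp 1 ≤ H) : 1 ≤ Real.log H :=
  (Real.le_log_iff_exp_le ((Real.exp_pos 1).trans_le hH)).2 hH

theorem card_good_points_le_mul_prime {F : ℤ[X][Y]} {b d p : ℕ} [hp : Fact p.Prime] (hd : 2 ≤ d)
    (hbd : b ≤ d) (hF : BidegreeLE F b d) (hirr : Irreducible (baseChange ℝ F))
    (hdeg : (baseChange ℝ F).natDegree = d) {H : ℝ} (hH : Real.exp 1 ≤ H)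
    {S : Finset (Fin 2 → ℚ)} (hS : ∀ P ∈ S, (ratHeight P : ℝ) ≤ H)
    (hgood : ∀ P ∈ S, IsGoodAt F b d p P) :
    (S.card : ℝ) ≤ 30 * d ^ 4 * Real.log H * H ^ (2 / (d : ℝ)) * p := by
  obtain ⟨e, rfl⟩ : ∃ e, d = e + 1 := ⟨d - 1, by omega⟩
  have hH1 : 1 ≤ H := (Real.one_le_exp zero_le_one).trans hH
  have hB : 1 ≤ Real.log H := one_le_log hH
  obtain ⟨m, hm⟩ : ∃ m, ⌈Real.log H⌉₊ = m + 1 :=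
    Nat.exists_eq_succ_of_ne_zero (Nat.ceil_pos.2 (by linarith)).ne'
  have hlog_le : Real.log H ≤ m + 1 := by exact_mod_cast hm ▸ Nat.le_ceil (Real.log H)
  have hm_le : (m : ℝ) ≤ Real.log H := by
    have h := Nat.ceil_lt_add_one (show 0 ≤ Real.log H by linarith)
    rw [hm] at h
    push_cast at h
    linarith
  obtain ⟨k, hk, hbig, hpow⟩ := exists_modulus_exponent hp.out.two_le hd hH1 hlog_le
  have hbezout : (b : ℝ) * e + m * (e + 1) ≤ (e + 1) ^ 2 * Real.log H := by
    have hbe : (b : ℝ) * e ≤ (e + 1) * e * Real.log H := by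
      rw [← mul_one ((b : ℝ) * e)]
      gcongr
      exact_mod_cast hbd
    have hme : (m : ℝ) * (e + 1) ≤ Real.log H * (e + 1) := by gcongr
    linarith
  have hcard : (S.card : ℝ) ≤ (e + 1) * (b * e + m * (e + 1)) * ((e + 1) * p ^ k) := by
    exact_mod_cast card_good_points_le hk hF hirr hdeg hbig hS hgood
  push_cast at hpow ⊢
  calc (S.card : ℝ) ≤ (e + 1) * (b * e + m * (e + 1)) * ((e + 1) * p ^ k) := hcard
    _ ≤ (e + 1) * ((e + 1) ^ 2 * Real.log H) *
        ((e + 1) * (30 * H ^ (2 / ((e : ℝ) + 1)) * p)) := by gcongr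
    _ = _ := by ring

theorem card_le_mul_of_forall_exists_prime {α : Type*} {r : ℕ → α → Prop} {S : Finset α} {n : ℕ}
    {M : ℝ} (hM0 : 0 ≤ M) (hr : ∀ P ∈ S, ∃ p, p.Prime ∧ p ≤ n ∧ r p P)
    (hM : ∀ p, p.Prime → p ≤ n → ∀ T ⊆ S, (∀ P ∈ T, r p P) → (T.card : ℝ) ≤ M) :
    (S.card : ℝ) ≤ n * M := by
  classical
  have hcover : S ⊆ (Nat.primesLE n).biUnion fun p => S.filter (r p) := by
    intro P hP
    obtain ⟨p, hp, hpn, hrp⟩ := hr P hP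
    exact Finset.mem_biUnion.2
      ⟨p, Nat.mem_primesLE.2 ⟨hpn, hp⟩, Finset.mem_filter.2 ⟨hP, hrp⟩⟩
  have hprimes : (Nat.primesLE n).card ≤ n := by
    have h : Nat.primesLE n ⊆ Finset.Icc 1 n := fun p hp =>
      Finset.mem_Icc.2 ⟨(Nat.prime_of_mem_primesLE hp).one_le, Nat.le_of_mem_primesLE hp⟩
    simpa using Finset.card_le_card h
  calc (S.card : ℝ) ≤ ∑ p ∈ Nat.primesLE n, ((S.filter (r p)).card : ℝ) := by
        exact_mod_cast (Finset.card_le_card hcover).trans Finset.card_biUnion_le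
    _ ≤ ∑ _p ∈ Nat.primesLE n, M := Finset.sum_le_sum fun p hp =>
        hM p (Nat.prime_of_mem_primesLE hp) (Nat.le_of_mem_primesLE hp) _
          (Finset.filter_subset _ _) fun P hP => (Finset.mem_filter.1 hP).2
    _ = (Nat.primesLE n).card * M := by rw [Finset.sum_const, nsmul_eq_mul]
    _ ≤ n * M := by gcongr

theorem card_smooth_points_le {F : ℤ[X][Y]} {b d : ℕ} (hd : 2 ≤ d) (hbd : b ≤ d)
    (hF : BidegreeLE F b d) (hirr : Irreducible (baseChange ℝ F))
    (hdeg : (baseChange ℝ F).natDegree = d) {H : ℝ} (hH : Real.exp 1 ≤ H)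
    (hW : ∀ i j, |((F.coeff j).coeff i : ℝ)| ≤ H ^ (8 * d ^ 3))
    {S : Finset (Fin 2 → ℚ)} (hS : ∀ P ∈ S, (ratHeight P : ℝ) ≤ H)
    (h0 : ∀ P ∈ S, bihomEval F b d P = 0)
    (hne : ∀ P ∈ S, bihomEval (derivative F) b (d - 1) P ≠ 0) :
    (S.card : ℝ) ≤ 30 * 1200 ^ 2 * d ^ 10 * Real.log H ^ 3 * H ^ (2 / (d : ℝ)) := by
  set B := Real.log H
  have hB : 1 ≤ B := one_le_log hH
  have hH0 : 0 ≤ H := (Real.exp_pos 1).le.trans hH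
  have hdB : 8 ≤ (d : ℝ) ^ 3 * B := by
    calc (8 : ℝ) = 2 ^ 3 * 1 := by norm_num
      _ ≤ (d : ℝ) ^ 3 * B := by gcongr; exact_mod_cast hd
  set n := ⌊1200 * (d : ℝ) ^ 3 * B⌋₊
  have hn_le : (n : ℝ) ≤ 1200 * d ^ 3 * B := Nat.floor_le (by positivity)
  have hlt_n : 1200 * (d : ℝ) ^ 3 * B < n + 1 := Nat.lt_floor_add_one _
  have hn : 9000 ≤ n := Nat.le_floor (by push_cast; linarith)
  have hcard : (S.card : ℝ) ≤ n * (30 * d ^ 4 * B * H ^ (2 / (d : ℝ)) * n) := by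
    refine card_le_mul_of_forall_exists_prime (by positivity)
      (fun P hP => exists_isGoodAt hd hbd hF hH hW (hS P hP) (h0 P hP) (hne P hP) hn (by linarith))
      fun p hp hpn T hTS hgood => ?_
    have : Fact p.Prime := ⟨hp⟩
    refine (card_good_points_le_mul_prime hd hbd hF hirr hdeg hH (fun P hP => hS P (hTS hP))
      hgood).trans ?_
    gcongr
  calc (S.card : ℝ) ≤ n * (30 * d ^ 4 * B * H ^ (2 / (d : ℝ)) * n) := hcard
    _ ≤ (1200 * d ^ 3 * B) * (30 * d ^ 4 * B * H ^ (2 / (d : ℝ)) * (1200 * d ^ 3 * B)) := by gcongr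
    _ = _ := by ring

theorem card_zeros_of_derivative_le {K : Type*} [Field K] [CharZero K] {f : K[X][Y]} {b c : ℕ}
    (hirr : Irreducible f)
    (hdeg : f.natDegree ≠ 0) (hf : BidegreeLE f b c) {S : Finset (Fin 2 → ℚ)}
    (h0 : ∀ P ∈ S, f.evalEval (P 0 : K) (P 1 : K) = 0)
    (hder : ∀ P ∈ S, f.derivative.evalEval (P 0 : K) (P 1 : K) = 0) :
    S.card ≤ c * (b * c + b * c) := by
  have hder0 : f.derivative ≠ 0 := fun h => hdeg (derivative_eq_zero.1 h)
  exact card_le_of_evalEval_eq_zero hirr hdeg hf (hf.derivative.mono le_rfl (Nat.sub_le _ _))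
    (not_dvd_of_natDegree_lt hder0 (natDegree_derivative_lt hdeg)) h0 hder

theorem card_points_le_of_integer_equation {F : ℤ[X][Y]} {b d : ℕ} (hd : 2 ≤ d) (hbd : b ≤ d)
    (hF : BidegreeLE F b d) (hirr : Irreducible (baseChange ℝ F))
    (hdeg : (baseChange ℝ F).natDegree = d) {H : ℝ} (hH : Real.exp 1 ≤ H)
    (hW : ∀ i j, |((F.coeff j).coeff i : ℝ)| ≤ H ^ (8 * d ^ 3))
    {S : Finset (Fin 2 → ℚ)} (hS : ∀ P ∈ S, (ratHeight P : ℝ) ≤ H)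
    (h0 : ∀ P ∈ S, (baseChange ℝ F).evalEval (P 0 : ℝ) (P 1 : ℝ) = 0) :
    (S.card : ℝ) ≤ (d * (b * d + b * d) : ℕ) +
      30 * 1200 ^ 2 * d ^ 10 * Real.log H ^ 3 * H ^ (2 / (d : ℝ)) := by
  classical
  rw [← Finset.card_filter_add_card_filter_not
    (fun P => bihomEval (derivative F) b (d - 1) P = 0), Nat.cast_add]
  gcongr
  · refine card_zeros_of_derivative_le hirr (by omega) (hF.map _)
      (fun P hP => h0 P (Finset.mem_of_mem_filter P hP)) fun P hP => ?_
    rw [derivative_map]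
    exact (bihomEval_int_eq_zero_iff hF.derivative).1 (Finset.mem_filter.1 hP).2
  · exact card_smooth_points_le hd hbd hF hirr hdeg hH hW
      (fun P hP => hS P (Finset.mem_of_mem_filter P hP))
      (fun P hP => (bihomEval_int_eq_zero_iff hF).2 (h0 P (Finset.mem_of_mem_filter P hP)))
      fun P hP => (Finset.mem_filter.1 hP).2

theorem card_points_le {f : ℝ[X][Y]} {b d : ℕ} (hirr : Irreducible f)
    (hdeg : f.natDegree = d) (hd : 2 ≤ d) (hbd : b ≤ d) (hfb : BidegreeLE f b d)
    (hb : ∃ j, f.coeff j ≠ 0 ∧ (f.coeff j).natDegree = b) {H : ℝ} (hH : Real.exp 1 ≤ H)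
    {S : Finset (Fin 2 → ℚ)} (hS : ∀ P ∈ S, (ratHeight P : ℝ) ≤ H)
    (h0 : ∀ P ∈ S, f.evalEval (P 0 : ℝ) (P 1 : ℝ) = 0) :
    (S.card : ℝ) ≤ (6 * (d : ℝ)) ^ 10 * H ^ (2 / (d : ℝ)) * Real.log H ^ 3 := by
  have hH1 : 1 ≤ H := (Real.one_le_exp zero_le_one).trans hH
  have hlog : 0 ≤ Real.log H := zero_le_one.trans (one_le_log hH)
  suffices h : (S.card : ℝ) ≤ (d * (b * d + b * d) : ℕ) +
      30 * 1200 ^ 2 * d ^ 10 * Real.log H ^ 3 * H ^ (2 / (d : ℝ)) by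
    have hbezout : ((d * (b * d + b * d) : ℕ) : ℝ) ≤
        2 * d ^ 10 * Real.log H ^ 3 * H ^ (2 / (d : ℝ)) := by
      have hd1 : (1 : ℝ) ≤ d := by exact_mod_cast one_le_two.trans hd
      calc ((d * (b * d + b * d) : ℕ) : ℝ) ≤ (d * (d * d + d * d) : ℕ) := by gcongr
        _ = 2 * d ^ 3 * 1 * 1 := by push_cast; ring
        _ ≤ 2 * d ^ 10 * Real.log H ^ 3 * H ^ (2 / (d : ℝ)) := by
          gcongr
          · norm_num
          · exact one_le_pow₀ (one_le_log hH)
          · exact Real.one_le_rpow hH1 (by positivity)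
    calc (S.card : ℝ) ≤ (2 + 30 * 1200 ^ 2) * (d ^ 10 * Real.log H ^ 3 * H ^ (2 / (d : ℝ))) := by
          linarith
      _ ≤ 6 ^ 10 * (d ^ 10 * Real.log H ^ 3 * H ^ (2 / (d : ℝ))) := by gcongr; norm_num
      _ = _ := by ring
  by_cases hcard : S.card ≤ d * (b * d + b * d)
  · exact (Nat.cast_le.2 hcard).trans (le_add_of_nonneg_right (by positivity))
  obtain ⟨F, hF, hW, t, ht, hFf⟩ :=
    exists_integer_equation hirr hdeg (by omega) hfb hb hH1 hS h0 (not_le.1 hcard)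
  have hunit : IsUnit (C (C t) : ℝ[X][Y]) := by simpa using ht
  refine card_points_le_of_integer_equation hd hbd hF ?_ ?_ hH
    (fun i j => (hW i j).trans (siegel_bound_le_pow hd hbd hH)) hS fun P hP => ?_
  · rwa [hFf, irreducible_mul_isUnit hunit]
  · rw [hFf, natDegree_mul hirr.ne_zero hunit.ne_zero, natDegree_C, hdeg, add_zero]
  · rw [hFf, evalEval_mul, h0 P hP, zero_mul]

section TwoVariables

variable {R : Type*} [CommRing R] (F : MvPolynomial (Fin 2) R)

theorem coeff_coeff_equivMvPolynomial_symm (s : Fin 2 →₀ ℕ) :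
    (((Bivariate.equivMvPolynomial R).symm F).coeff (s 1)).coeff (s 0) = F.coeff s := by
  induction F using MvPolynomial.induction_on' with
  | monomial u a =>
    have hmonomial : (Bivariate.equivMvPolynomial R).symm (MvPolynomial.monomial u a) =
        monomial (u 1) (monomial (u 0) a) := by
      rw [MvPolynomial.monomial_eq, Finsupp.prod_fintype _ _ (by simp), map_mul, map_prod,
        Fin.prod_univ_two]
      simp only [map_pow, Bivariate.equivMvPolynomial_symm_C, Bivariate.equivMvPolynomial_symm_X_0,
        Bivariate.equivMvPolynomial_symm_X_1]
      rw [← C_mul_X_pow_eq_monomial, ← C_mul_X_pow_eq_monomial, C_mul, C_pow, mul_assoc]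
    have hiff : u = s ↔ u 1 = s 1 ∧ u 0 = s 0 := by
      rw [DFunLike.ext_iff, Fin.forall_fin_two, and_comm]
    rw [hmonomial, MvPolynomial.coeff_monomial, coeff_monomial]
    by_cases h : u 1 = s 1
    · rw [if_pos h, coeff_monomial]
      simp [hiff, h]
    · simp [hiff, h]
  | add p q hp hq => simp [hp, hq]

theorem evalEval_equivMvPolynomial_symm (v : Fin 2 → R) :
    ((Bivariate.equivMvPolynomial R).symm F).evalEval (v 0) (v 1) = MvPolynomial.eval v F := by
  have h : ((evalEvalRingHom (v 0) (v 1)).comp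
      ((Bivariate.equivMvPolynomial R).symm : MvPolynomial (Fin 2) R →+* R[X][Y])) =
      MvPolynomial.eval v := by
    refine MvPolynomial.ringHom_ext (fun r => by simp) fun i => ?_
    fin_cases i <;> simp
  exact congrArg (fun φ : MvPolynomial (Fin 2) R →+* R => φ F) h

theorem bidegreeLE_equivMvPolynomial_symm :
    BidegreeLE ((Bivariate.equivMvPolynomial R).symm F) (F.degreeOf 0) (F.degreeOf 1) := by
  have hzero (i j : ℕ) (hij : F.degreeOf 0 < i ∨ F.degreeOf 1 < j) :
      (((Bivariate.equivMvPolynomial R).symm F).coeff j).coeff i = 0 := by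
    obtain ⟨s, rfl, rfl⟩ : ∃ s : Fin 2 →₀ ℕ, s 0 = i ∧ s 1 = j :=
      ⟨Finsupp.equivFunOnFinite.symm ![i, j], by simp, by simp⟩
    rw [coeff_coeff_equivMvPolynomial_symm]
    by_contra hs
    have h0 := MvPolynomial.monomial_le_degreeOf 0 (MvPolynomial.mem_support_iff.2 hs)
    have h1 := MvPolynomial.monomial_le_degreeOf 1 (MvPolynomial.mem_support_iff.2 hs)
    omega
  refine ⟨natDegree_le_iff_coeff_eq_zero.2 fun j hj => ?_,
    fun j => natDegree_le_iff_coeff_eq_zero.2 fun i hi => hzero i j (Or.inl hi)⟩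
  ext i
  rw [hzero i j (Or.inr hj), coeff_zero]

variable {F}

theorem exists_coeff_ne_zero_of_degreeOf {σ : Type*} {F : MvPolynomial σ R} (hF : F ≠ 0) (i : σ) :
    ∃ s, F.coeff s ≠ 0 ∧ s i = F.degreeOf i := by
  classical
  obtain ⟨s, hs, h⟩ := Finset.exists_mem_eq_sup F.support (MvPolynomial.support_nonempty.2 hF)
    (fun s => s i)
  exact ⟨s, MvPolynomial.mem_support_iff.1 hs, by rw [MvPolynomial.degreeOf_eq_sup, h]⟩

theorem natDegree_equivMvPolynomial_symm (hF : F ≠ 0) :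
    ((Bivariate.equivMvPolynomial R).symm F).natDegree = F.degreeOf 1 := by
  refine le_antisymm (bidegreeLE_equivMvPolynomial_symm F).natDegree_le ?_
  obtain ⟨s, hs, hs1⟩ := exists_coeff_ne_zero_of_degreeOf hF 1
  rw [← coeff_coeff_equivMvPolynomial_symm] at hs
  rw [← hs1]
  exact le_natDegree_of_ne_zero fun h => hs (by rw [h, coeff_zero])

theorem exists_natDegree_coeff_equivMvPolynomial_symm (hF : F ≠ 0) :
    ∃ j, ((Bivariate.equivMvPolynomial R).symm F).coeff j ≠ 0 ∧
      (((Bivariate.equivMvPolynomial R).symm F).coeff j).natDegree = F.degreeOf 0 := by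
  obtain ⟨s, hs, hs0⟩ := exists_coeff_ne_zero_of_degreeOf hF 0
  rw [← coeff_coeff_equivMvPolynomial_symm] at hs
  refine ⟨s 1, fun h => hs (by rw [h, coeff_zero]),
    le_antisymm ((bidegreeLE_equivMvPolynomial_symm F).natDegree_coeff_le _) ?_⟩
  rw [← hs0]
  exact le_natDegree_of_ne_zero hs

end TwoVariables

theorem countRatPoints_le_of_degreeOf_le {F : MvPolynomial (Fin 2) ℝ} (hF : Irreducible F) {d : ℕ}
    (hd : 2 ≤ d) (h0 : F.degreeOf 0 ≤ d) (h1 : F.degreeOf 1 = d) {H : ℝ}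
    (hH : Real.exp 1 ≤ H) :
    (countRatPoints (realZeroSet F) H : ℝ) ≤
      (6 * (d : ℝ)) ^ 10 * H ^ (2 / (d : ℝ)) * Real.log H ^ 3 := by
  subst h1
  rw [countRatPoints, Set.ncard_eq_toFinset_card _ (ratPoints_finite _ _)]
  refine card_points_le ((MulEquiv.irreducible_iff (Bivariate.equivMvPolynomial ℝ).symm).2 hF)
    (natDegree_equivMvPolynomial_symm hF.ne_zero) hd h0 (bidegreeLE_equivMvPolynomial_symm F)
    (exists_natDegree_coeff_equivMvPolynomial_symm hF.ne_zero) hH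
    (fun P hP => ((Set.Finite.mem_toFinset _).1 hP).2) fun P hP => ?_
  exact (evalEval_equivMvPolynomial_symm F fun j => (P j : ℝ)).trans
    ((Set.Finite.mem_toFinset _).1 hP).1

theorem countRatPoints_le_rename_swap (F : MvPolynomial (Fin 2) ℝ) (H : ℝ) :
    countRatPoints (realZeroSet F) H ≤
      countRatPoints (realZeroSet (MvPolynomial.rename (Equiv.swap 0 1) F)) H := by
  refine Set.ncard_le_ncard_of_injOn (fun P => P ∘ Equiv.swap 0 1) ?_
    ((Equiv.swap (0 : Fin 2) 1).surjective.injective_comp_right.injOn) (ratPoints_finite _ _)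
  rintro P ⟨hP, hPH⟩
  constructor
  · have hswap : (fun j => ((P ∘ Equiv.swap 0 1) j : ℝ)) ∘ Equiv.swap (0 : Fin 2) 1 =
        fun j => (P j : ℝ) := by
      ext j
      simp
    rwa [realZeroSet, Set.mem_ofPred_eq, MvPolynomial.eval_rename, hswap]
  · refine le_trans (Nat.cast_le.2 (Finset.sup_le fun j _ => ?_)) hPH
    exact Finset.le_sup (f := fun j => max (P j).num.natAbs (P j).den)
      (Finset.mem_univ (Equiv.swap 0 1 j))

theorem theorem1p4_general {F : MvPolynomial (Fin 2) ℝ} (hF : Irreducible F) {d : ℕ} (hd : 2 ≤ d)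
    (hFd : d = max (F.degreeOf 0) (F.degreeOf 1)) {H : ℝ} (hH : Real.exp 1 ≤ H) :
    (countRatPoints (realZeroSet F) H : ℝ) ≤
      (6 * (d : ℝ)) ^ 10 * H ^ (2 / (d : ℝ)) * Real.log H ^ 3 := by
  rcases le_total (F.degreeOf 0) (F.degreeOf 1) with hle | hle
  · rw [max_eq_right hle] at hFd
    exact countRatPoints_le_of_degreeOf_le hF hd (hle.trans_eq hFd.symm) hFd.symm hH
  · rw [max_eq_left hle] at hFd
    let σ : Equiv.Perm (Fin 2) := Equiv.swap 0 1
    have hdegree (i : Fin 2) : (MvPolynomial.rename σ F).degreeOf (σ i) = F.degreeOf i :=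
      MvPolynomial.degreeOf_rename_of_injective σ.injective i
    have hirr : Irreducible (MvPolynomial.rename σ F) :=
      (MulEquiv.irreducible_iff (MvPolynomial.renameEquiv ℝ σ)).2 hF
    refine (Nat.cast_le.2 (countRatPoints_le_rename_swap F H)).trans
      (countRatPoints_le_of_degreeOf_le hirr hd ?_ ?_ hH)
    · exact (hdegree 1).trans_le (hle.trans_eq hFd.symm)
    · exact (hdegree 0).trans hFd.symm

theorem theorem1p4 (b c : ℕ) (hb : 2 ≤ b) (hc : 2 ≤ c) (H : ℝ) (hH : 3 ≤ H)
    (F : MvPolynomial (Fin 2) ℝ) (hF : Irreducible F) (hbc : HasBidegree F b c)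
    (d : ℕ) (hd : d = max b c) :
    (countRatPoints (realZeroSet F) H : ℝ) ≤
      (6 * (d : ℝ)) ^ 10 * 4 ^ d * H ^ (2 / (d : ℝ)) * (Real.log H) ^ 5 := by
  obtain ⟨rfl, rfl⟩ := hbc
  have hHe : Real.exp 1 ≤ H := by linarith [Real.exp_one_lt_d9]
  have hlog : 1 ≤ Real.log H := one_le_log hHe
  have : 0 < Real.log H := zero_lt_one.trans_le hlog
  refine (theorem1p4_general hF (hd ▸ le_max_of_le_left hb) hd hHe).trans ?_
  gcongr
  · exact le_mul_of_one_le_right (by positivity) (one_le_pow₀ (by norm_num))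
  · norm_num
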